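/- Let $\mathcal X,\mathcal U,\mathcal Y$ be complex Hilbert spaces. For a Schur-class function $S\in\mathcal S(\mathcal U,\mathcal Y)$ (analytic on the unit disk $\mathbb D$ with contractive values in $\mathcal L(\mathcal U,\mathcal Y)$) let $\mathcal H(S)$ be the de Branges–Rovnyak space, i.e. the reproducing kernel Hilbert space of $\mathcal Y$-valued functions on $\mathbb D$ with kernel $K_S(z,\zeta)=\frac{I-S(z)S(\zeta)^*}{1-z\overline\zeta}$; adjoints of operators into $\mathcal H(S)$ are taken in the metric of $\mathcal H(S)$ and written $[*]$. **Data.** Let $S\in\mathcal S(\mathcal U,\mathcal Y)$, $T\in\mathcal L(\mathcal X)$, $E\in\mathcal L(\mathcal X,\mathcal Y)$, $N\in\mathcal L(\mathcal X,\mathcal U)$, $\mathbf y\in\mathcal L(\mathcal X,\mathbb C)$ be an $\mathbf{AIP}_{\mathcal H(S)}$-admissible data set: (1) for every $x\in\mathcal X$ the function $\left[\begin{smallmatrix}E\\N\end{smallmatrix}\right](I-zT)^{-1}x$ is holomorphic on $\mathbb D$ (i.e. its Taylor series $\sum_n z^n\left[\begin{smallmatrix}E\\N\end{smallmatrix}\right]T^nx$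 converges on $\mathbb D$); (2) $F^S$, defined by $(F^Sx)(z)=(E-S(z)N)(I-zT)^{-1}x$, maps $\mathcal X$ into $\mathcal H(S)$; (3) $P:=(F^S)^{[*]}F^S$ satisfies $P-T^*PT=E^*E-N^*N$. A solution of $\mathbf{AIP}_{\mathcal H(S)}$ is an $f\in\mathcal H(S)$ with $(F^S)^{[*]}f=\mathbf y^*$ (where $\mathbf y^*\in\mathcal X$ is the vector representing $\mathbf y$) and $\|f\|_{\mathcal H(S)}\le1$. Assume the solvability condition $P\ge\mathbf y^*\mathbf y$; $P$ is not assumed invertible. **Colligation.** Let $\mathcal X_0=\overline{\operatorname{Ran}}\,P^{1/2}=\mathcal X\ominus\operatorname{Ker}P$, let $V$ be the isometry from $\mathcal D_V=\overline{\operatorname{Ran}}\left[\begin{smallmatrix}P^{1/2}\\N\end{smallmatrix}\right]\subseteq\mathcal X_0\oplus\mathcal U$ onto $\mathcal R_V=\overline{\operatorname{Ran}}\left[\begin{smallmatrix}P^{1/2}T\\E\end{smallmatrix}\right]\subseteq\mathcal X_0\oplus\mathcal Y$ with $V\left[\begin{smallmatrix}P^{1/2}x\\Nx\end{smallmatrix}\right]=\left[\begin{smallmatrix}P^{1/2}Tx\\Ex\end{smallmatrix}\right]$,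 let $\Delta=(\mathcal X_0\oplus\mathcal U)\ominus\mathcal D_V$, $\Delta_*=(\mathcal X_0\oplus\mathcal Y)\ominus\mathcal R_V$, and let $\mathbf i:\Delta\to\widetilde\Delta$, $\mathbf i_*:\Delta_*\to\widetilde\Delta_*$ be unitary identifications with Hilbert spaces $\widetilde\Delta,\widetilde\Delta_*$. Let $$\mathbf U=\begin{bmatrix}V&0&0\\0&0&\mathbf i_*^*\\0&\mathbf i&0\end{bmatrix}:\mathcal D_V\oplus\Delta\oplus\widetilde\Delta_*\to\mathcal R_V\oplus\Delta_*\oplus\widetilde\Delta,\qquad \mathbf U=\begin{bmatrix}A&B_1&B_2\\C_1&D_{11}&D_{12}\\C_2&D_{21}&0\end{bmatrix}:\mathcal X_0\oplus\mathcal U\oplus\widetilde\Delta_*\to\mathcal X_0\oplus\mathcal Y\oplus\widetilde\Delta,$$ and let $\Sigma=\left[\begin{smallmatrix}\Sigma_{11}&\Sigma_{12}\\\Sigma_{21}&\Sigma_{22}\end{smallmatrix}\right]$ be its characteristic function $\Sigma(z)=\left[\begin{smallmatrix}D_{11}&D_{12}\\D_{21}&0\end{smallmatrix}\right]+z\left[\begin{smallmatrix}C_1\\C_2\end{smallmatrix}\right](I-zA)^{-1}\left[\begin{smallmatrix}B_1&B_2\end{smallmatrix}\right]$.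 **Theorem.** There is a unique $\widetilde{\mathbf y}^*\in\mathcal X_0$ with $P^{1/2}\widetilde{\mathbf y}^*=\mathbf y^*$, and $\|\widetilde{\mathbf y}\|:=\|\widetilde{\mathbf y}^*\|_{\mathcal X}\le1$. There is at least one $\mathcal E\in\mathcal S(\widetilde\Delta,\widetilde\Delta_*)$ with $$S=\mathcal R_\Sigma[\mathcal E]:=\Sigma_{11}+\Sigma_{12}(I-\mathcal E\Sigma_{22})^{-1}\mathcal E\Sigma_{21}\quad\text{on }\mathbb D.$$ For every such $\mathcal E$, put $G=\Sigma_{12}(I-\mathcal E\Sigma_{22})^{-1}$ and $\Gamma(z)=(C_1+G(z)\mathcal E(z)C_2)(I-zA)^{-1}$. Then: 1. A function $f:\mathbb D\to\mathcal Y$ is a solution of $\mathbf{AIP}_{\mathcal H(S)}$ if and only if $$f(z)=\Gamma(z)\widetilde{\mathbf y}^*+G(z)h(z)\qquad(z\in\mathbb D)$$ for some $h\in\mathcal H(\mathcal E)$ with $\|h\|_{\mathcal H(\mathcal E)}\le\sqrt{1-\|\widetilde{\mathbf y}\|^2}$. 2. $\Gamma\widetilde{\mathbf y}^*\in\mathcal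 H(S)$, multiplication $M_G:h\mapsto Gh$ is a bounded operator from $\mathcal H(\mathcal E)$ to $\mathcal H(S)$, and for every $h\in\mathcal H(\mathcal E)$ the function $f=\Gamma\widetilde{\mathbf y}^*+Gh$ satisfies $$\|f\|^2_{\mathcal H(S)}=\|\Gamma\widetilde{\mathbf y}^*\|^2_{\mathcal H(S)}+\|Gh\|^2_{\mathcal H(S)}=\|\widetilde{\mathbf y}\|^2+\|P_{\mathcal H(\mathcal E)\ominus\operatorname{Ker}M_G}h\|^2_{\mathcal H(\mathcal E)},$$ where $P_{\mathcal H(\mathcal E)\ominus\operatorname{Ker}M_G}$ is the orthogonal projection of $\mathcal H(\mathcal E)$ onto $\mathcal H(\mathcal E)\ominus\operatorname{Ker}M_G$. 3. $f_{\min}=\Gamma\widetilde{\mathbf y}^*$ is a solution and every other solution has strictly larger $\mathcal H(S)$-norm. -/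

import Mathlib

open scoped InnerProductSpace ComplexConjugate Complex.UnitDisc

noncomputable section

namespace DBR

/-- The Schur class `𝒮(𝒰, 𝒴)`: analytic functions on the open unit disk whose values are
contractions from `𝒰` to `𝒴`. Only the values on the disk are ever used. -/
structure SchurFunction (𝒰 𝒴 : Type*) [NormedAddCommGroup 𝒰] [InnerProductSpace ℂ 𝒰]
    [NormedAddCommGroup 𝒴] [InnerProductSpace ℂ 𝒴] where
  toFun : ℂ → 𝒰 →L[ℂ] 𝒴
  differentiableOn : DifferentiableOn ℂ toFun (Metric.ball 0 1)
  norm_le_one : ∀ z ∈ Metric.ball (0 : ℂ) 1, ‖toFun z‖ ≤ 1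

instance {𝒰 𝒴 : Type*} [NormedAddCommGroup 𝒰] [InnerProductSpace ℂ 𝒰]
    [NormedAddCommGroup 𝒴] [InnerProductSpace ℂ 𝒴] :
    CoeFun (SchurFunction 𝒰 𝒴) (fun _ => ℂ → 𝒰 →L[ℂ] 𝒴) := ⟨SchurFunction.toFun⟩

section Kernel

/-- `1 / (1 - conj z w / r²)` -/
def szegoAux (r : ℝ) (z w : ℂ) : ℂ := (r : ℂ) ^ 2 / ((r : ℂ) ^ 2 - conj z * w)

theorem szegoAux_den_ne {r : ℝ} {z w : ℂ} (hz : ‖z‖ < r) (hw : ‖w‖ ≤ r) :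
    (r : ℂ) ^ 2 - conj z * w ≠ 0 := by
  intro h
  have h2 : ‖(r : ℂ) ^ 2‖ = ‖conj z * w‖ := by rw [sub_eq_zero.mp h]
  have hr : 0 < r := (norm_nonneg z).trans_lt hz
  simp only [norm_pow, Complex.norm_real, Real.norm_eq_abs, abs_of_pos hr, norm_mul,
    RCLike.norm_conj] at h2
  nlinarith [norm_nonneg z, norm_nonneg w]

theorem circleAverage_szegoAux {V : Type*} [NormedAddCommGroup V] [InnerProductSpace ℂ V]
    {ι : Type*} (s : Finset ι) {r : ℝ} (hr : 0 < r) (z : ι → ℂ) (hz : ∀ j ∈ s, ‖z j‖ < r)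
    (v : ι → V) {h : ℂ → V} (hh : DiffContOnCl ℂ h (Metric.ball 0 r)) :
    Real.circleAverage (fun w => ⟪∑ j ∈ s, szegoAux r (z j) w • v j, h w⟫_ℂ) 0 r
      = ∑ j ∈ s, ⟪v j, h (z j)⟫_ℂ := by
  have hc : ContinuousOn h (Metric.closedBall 0 r) := by
    have := hh.2
    rwa [closure_ball _ hr.ne'] at this
  have h1 : Real.circleAverage (fun w => ⟪∑ j ∈ s, szegoAux r (z j) w • v j, h w⟫_ℂ) 0 r
      = Real.circleAverage
        (fun w => ∑ j ∈ s, ((w - 0) / (w - z j)) • ⟪v j, h w⟫_ℂ) 0 r := by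
    apply Real.circleAverage_congr_sphere
    intro w hw
    have hw' : ‖w‖ = r := by simpa [abs_of_pos hr] using hw
    simp only [sum_inner, inner_smul_left]
    refine Finset.sum_congr rfl fun j hj => ?_
    have hd := szegoAux_den_ne (hz j hj) hw'.le
    have hww : w * conj w = (r : ℂ) ^ 2 := by
      rw [Complex.mul_conj, Complex.normSq_eq_norm_sq, hw']; simp
    have hw0 : w ≠ 0 := by
      intro h0; simp [h0] at hw'; exact hr.ne hw'
    have hwz : w - z j ≠ 0 := by
      intro h0
      have := hz j hj
      rw [← sub_eq_zero.mp h0, hw'] at this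
      exact lt_irrefl _ this
    have hw0' : conj w ≠ 0 := by simpa using hw0
    have : conj (szegoAux r (z j) w) = (w - 0) / (w - z j) := by
      simp only [szegoAux, map_div₀, map_sub, map_mul, map_pow, Complex.conj_ofReal,
        Complex.conj_conj, sub_zero]
      rw [← hww, show w * conj w - z j * conj w = conj w * (w - z j) by ring]
      field_simp
    rw [this]; rfl
  rw [h1, Real.circleAverage_fun_sum]
  · refine Finset.sum_congr rfl fun j hj => ?_
    have hd : DiffContOnCl ℂ (fun w => ⟪v j, h w⟫_ℂ) (Metric.ball 0 |r|) := by
      rw [abs_of_pos hr]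
      exact (innerSL ℂ (v j)).differentiable.comp_diffContOnCl hh
    exact hd.circleAverage_smul_div (by simpa [abs_of_pos hr] using hz j hj)
  · intro j hj
    apply ContinuousOn.circleIntegrable'
    rw [abs_of_pos hr]
    have hi : ContinuousOn (fun w => ⟪v j, h w⟫_ℂ) (Metric.sphere 0 r) :=
      ((innerSL ℂ (v j)).continuous.comp_continuousOn hc).mono Metric.sphere_subset_closedBall
    refine ContinuousOn.smul (ContinuousOn.div (continuousOn_id.sub continuousOn_const)
      (continuousOn_id.sub continuousOn_const) ?_) hi
    intro w hw h0
    have hw' : ‖w‖ = r := by simpa using hw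
    have := hz j hj
    rw [← sub_eq_zero.mp (show w - z j = 0 from h0), hw'] at this
    exact lt_irrefl _ this

variable {𝒰 𝒴 : Type*} [NormedAddCommGroup 𝒰] [InnerProductSpace ℂ 𝒰] [CompleteSpace 𝒰]
    [NormedAddCommGroup 𝒴] [InnerProductSpace ℂ 𝒴] [CompleteSpace 𝒴]

/-- The de Branges–Rovnyak kernel `K_S(z, ζ) = (I - S(z) S(ζ)^*) / (1 - z conj ζ)`. -/
def dbrKernel (S : SchurFunction 𝒰 𝒴) : Matrix 𝔻 𝔻 (𝒴 →L[ℂ] 𝒴) :=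
  .of fun z ζ => (1 - (z : ℂ) * conj (ζ : ℂ))⁻¹ •
    (1 - S z ∘L (S ζ).adjoint)

theorem diffContOnCl_szegoAux_sum {V : Type*} [NormedAddCommGroup V] [InnerProductSpace ℂ V]
    {ι : Type*} (s : Finset ι) {r : ℝ} (hr : 0 < r) (z : ι → ℂ) (hz : ∀ j ∈ s, ‖z j‖ < r)
    (v : ι → V) :
    DiffContOnCl ℂ (fun w => ∑ j ∈ s, szegoAux r (z j) w • v j) (Metric.ball 0 r) := by
  apply DifferentiableOn.diffContOnCl
  rw [closure_ball _ hr.ne']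
  refine DifferentiableOn.fun_sum fun j hj => DifferentiableOn.smul_const ?_ _
  unfold szegoAux
  refine DifferentiableOn.div (by fun_prop) (by fun_prop) fun w hw => ?_
  exact szegoAux_den_ne (hz j hj) (by simpa using hw)

theorem re_sum_szegoAux_nonneg (S : SchurFunction 𝒰 𝒴) {ι : Type*} (s : Finset ι) {r : ℝ}
    (hr : 0 < r) (hr1 : r < 1) (z : ι → ℂ) (hz : ∀ j ∈ s, ‖z j‖ < r) (v : ι → 𝒴) :
    0 ≤ (∑ i ∈ s, ∑ j ∈ s, szegoAux r (z j) (z i) *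
      (⟪v i, v j⟫_ℂ - ⟪(S (z i)).adjoint (v i), (S (z j)).adjoint (v j)⟫_ℂ)).re := by
  set f : ℂ → 𝒴 := fun w => ∑ j ∈ s, szegoAux r (z j) w • v j with hf
  set g : ℂ → 𝒰 := fun w => ∑ j ∈ s, szegoAux r (z j) w • (S (z j)).adjoint (v j) with hg
  have hfd : DiffContOnCl ℂ f (Metric.ball 0 r) := diffContOnCl_szegoAux_sum s hr z hz v
  have hgd : DiffContOnCl ℂ g (Metric.ball 0 r) := diffContOnCl_szegoAux_sum s hr z hz _
  have hSd : DiffContOnCl ℂ S.toFun (Metric.ball 0 r) := by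
    apply DifferentiableOn.diffContOnCl
    rw [closure_ball _ hr.ne']
    exact S.differentiableOn.mono (Metric.closedBall_subset_ball hr1)
  have hSg : DiffContOnCl ℂ (fun w => S w (g w)) (Metric.ball 0 r) :=
    ⟨hSd.1.clm_apply hgd.1, hSd.2.clm_apply hgd.2⟩
  have e1 := circleAverage_szegoAux s hr z hz v hfd
  have e2 := circleAverage_szegoAux s hr z hz v hSg
  have e3 := circleAverage_szegoAux s hr z hz (fun j => (S (z j)).adjoint (v j)) hgd
  have hcl : ∀ {W : Type _} [NormedAddCommGroup W] [InnerProductSpace ℂ W] {a b : ℂ → W},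
      DiffContOnCl ℂ a (Metric.ball 0 r) → DiffContOnCl ℂ b (Metric.ball 0 r) →
      CircleIntegrable (fun w => ⟪a w, b w⟫_ℂ) 0 r := by
    intro W _ _ a b ha hb
    apply ContinuousOn.circleIntegrable'
    rw [abs_of_pos hr]
    have h1 := ha.2
    have h2 := hb.2
    rw [closure_ball _ hr.ne'] at h1 h2
    exact (h1.mono Metric.sphere_subset_closedBall).inner
      (h2.mono Metric.sphere_subset_closedBall)
  have i1 := hcl hfd hfd
  have i2 := hcl hfd hSg
  have i3 : CircleIntegrable (fun w => ⟪g w, g w⟫_ℂ) 0 r := by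
    apply ContinuousOn.circleIntegrable'
    rw [abs_of_pos hr]
    have h1 := hgd.2
    rw [closure_ball _ hr.ne'] at h1
    exact (h1.mono Metric.sphere_subset_closedBall).inner
      (h1.mono Metric.sphere_subset_closedBall)
  have e23 : ∑ j ∈ s, ⟪v j, S (z j) (g (z j))⟫_ℂ
      = ∑ j ∈ s, ⟪(S (z j)).adjoint (v j), g (z j)⟫_ℂ := by
    simp only [ContinuousLinearMap.adjoint_inner_left]
  have key : ∑ i ∈ s, ∑ j ∈ s, szegoAux r (z j) (z i) *
      (⟪v i, v j⟫_ℂ - ⟪(S (z i)).adjoint (v i), (S (z j)).adjoint (v j)⟫_ℂ)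
      = Real.circleAverage (fun w => (⟪f w, f w⟫_ℂ - ⟪f w, S w (g w)⟫_ℂ)
        - (⟪f w, S w (g w)⟫_ℂ - ⟪g w, g w⟫_ℂ)) 0 r := by
    have a1 := Real.circleAverage_fun_sub (i1.sub i2) (i2.sub i3)
    simp only [Pi.sub_apply] at a1
    rw [a1, show ((fun w => ⟪f w, f w⟫_ℂ) - fun w => ⟪f w, S w (g w)⟫_ℂ)
        = fun w => ⟪f w, f w⟫_ℂ - ⟪f w, S w (g w)⟫_ℂ from rfl,
      show ((fun w => ⟪f w, S w (g w)⟫_ℂ) - fun w => ⟪g w, g w⟫_ℂ)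
        = fun w => ⟪f w, S w (g w)⟫_ℂ - ⟪g w, g w⟫_ℂ from rfl,
      Real.circleAverage_fun_sub i1 i2, Real.circleAverage_fun_sub i2 i3]
    rw [e1, e2, e3, e23, sub_self, sub_zero, ← Finset.sum_sub_distrib]
    refine Finset.sum_congr rfl fun i _ => ?_
    simp only [hf, hg, inner_sum, inner_smul_right, ← Finset.sum_sub_distrib, mul_sub]
  have hre := Complex.reCLM.circleAverage_comp_comm (((i1.sub i2).sub (i2.sub i3)))
  rw [key]
  have : (Real.circleAverage (fun w => (⟪f w, f w⟫_ℂ - ⟪f w, S w (g w)⟫_ℂ)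
        - (⟪f w, S w (g w)⟫_ℂ - ⟪g w, g w⟫_ℂ)) 0 r).re = _ := hre.symm
  rw [this]
  apply Real.circleAverage_nonneg_of_nonneg
  intro w hw
  have hw' : ‖w‖ = r := by simpa [abs_of_pos hr] using hw
  have hS : ‖S w (g w)‖ ≤ ‖g w‖ := by
    have := S.norm_le_one w (by simpa [hw'] using hr1)
    simpa using (S w).le_of_opNorm_le this (g w)
  have h0 : (0 : ℝ) ≤ ‖f w - S w (g w)‖ ^ 2 := sq_nonneg _
  rw [@norm_sub_sq ℂ] at h0
  have n1 : (⟪f w, f w⟫_ℂ).re = ‖f w‖ ^ 2 := by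
    simpa using @inner_self_eq_norm_sq ℂ _ _ _ _ (f w)
  have n2 : (⟪g w, g w⟫_ℂ).re = ‖g w‖ ^ 2 := by
    simpa using @inner_self_eq_norm_sq ℂ _ _ _ _ (g w)
  simp only [Function.comp_apply, Pi.sub_apply, Complex.reCLM_apply, Complex.sub_re, n1, n2]
  have h0' : RCLike.re (⟪f w, S w (g w)⟫_ℂ) = (⟪f w, S w (g w)⟫_ℂ).re := rfl
  rw [h0'] at h0
  have := norm_nonneg (S w (g w))
  nlinarith

theorem dbrKernel_posSemidef (S : SchurFunction 𝒰 𝒴) : (dbrKernel S).PosSemidef := by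
  have key := (RKHS.posSemidef_tfae (K := dbrKernel S)).out 0 2
  refine key.mpr ⟨?_, fun vv => ?_⟩
  · ext z ζ y
    simp [dbrKernel, Matrix.conjTranspose_apply, ContinuousLinearMap.star_eq_adjoint,
      ContinuousLinearMap.adjoint_comp, mul_comm]
  · set c : 𝔻 → 𝔻 → ℂ := fun i j =>
      ⟪vv i, vv j⟫_ℂ - ⟪(S i).adjoint (vv i), (S j).adjoint (vv j)⟫_ℂ with hc
    have hlim : Filter.Tendsto (fun r : ℝ => (∑ i ∈ vv.support, ∑ j ∈ vv.support,
        szegoAux r j i * c i j).re) (nhdsWithin 1 (Set.Iio 1))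
        (nhds (∑ i ∈ vv.support, ∑ j ∈ vv.support, szegoAux 1 j i * c i j).re) := by
      have hct : ContinuousAt (fun r : ℝ => (∑ i ∈ vv.support, ∑ j ∈ vv.support,
        szegoAux r j i * c i j).re) 1 := by
        refine Complex.continuous_re.continuousAt.comp ?_
        refine tendsto_finsetSum _ fun i _ => tendsto_finsetSum _ fun j _ => ?_
        refine ContinuousAt.mul (f := fun r : ℝ => szegoAux r j i) ?_ continuousAt_const
        unfold szegoAux
        refine ContinuousAt.div (by fun_prop) (by fun_prop) ?_
        exact szegoAux_den_ne j.norm_lt_one i.norm_lt_one.le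
      exact hct.tendsto.mono_left nhdsWithin_le_nhds
    have hpos : ∀ᶠ r : ℝ in nhdsWithin 1 (Set.Iio 1), 0 ≤ (∑ i ∈ vv.support, ∑ j ∈ vv.support,
        szegoAux r j i * c i j).re := by
      have h1 : ∀ᶠ r : ℝ in nhdsWithin 1 (Set.Iio 1), ∀ j ∈ vv.support, ‖(j : ℂ)‖ < r := by
        rw [Filter.eventually_all_finset]
        intro j _
        exact nhdsWithin_le_nhds (eventually_gt_nhds j.norm_lt_one)
      have h2 : ∀ᶠ r : ℝ in nhdsWithin 1 (Set.Iio 1), 0 < r :=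
        nhdsWithin_le_nhds (eventually_gt_nhds one_pos)
      filter_upwards [h1, h2, self_mem_nhdsWithin] with r hr hr0 hr1
      exact re_sum_szegoAux_nonneg S vv.support hr0 hr1 (fun j : 𝔻 => (j : ℂ)) hr vv
    have h := ge_of_tendsto hlim hpos
    refine h.trans_eq (congrArg _ ?_)
    simp only [Finsupp.sum]
    refine Finset.sum_congr rfl fun i _ => Finset.sum_congr rfl fun j _ => ?_
    simp [dbrKernel, szegoAux, hc, inner_smul_left, inner_sub_left, mul_comm,
      ContinuousLinearMap.adjoint_inner_right]

instance (S : SchurFunction 𝒰 𝒴) : Fact (dbrKernel S).PosSemidef := ⟨dbrKernel_posSemidef S⟩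

/-- The de Branges–Rovnyak space `H(S)`: the reproducing kernel Hilbert space of `𝒴`-valued functions
on the unit disk whose reproducing kernel is `K_S`. -/
abbrev H (S : SchurFunction 𝒰 𝒴) := RKHS.OfKernel (dbrKernel S)

end Kernel

section Interpolation

variable {𝒳 𝒰 𝒴 : Type*}
  [NormedAddCommGroup 𝒳] [InnerProductSpace ℂ 𝒳] [CompleteSpace 𝒳]
  [NormedAddCommGroup 𝒰] [InnerProductSpace ℂ 𝒰] [CompleteSpace 𝒰]
  [NormedAddCommGroup 𝒴] [InnerProductSpace ℂ 𝒴] [CompleteSpace 𝒴]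

/-- The function `z ↦ C (I - z T)⁻¹ x`, as the sum of its Taylor series `∑ zⁿ C Tⁿ x` at `0`. -/
def obs {𝒲 : Type*} [NormedAddCommGroup 𝒲] [InnerProductSpace ℂ 𝒲]
    (C : 𝒳 →L[ℂ] 𝒲) (T : 𝒳 →L[ℂ] 𝒳) (x : 𝒳) (z : ℂ) : 𝒲 :=
  ∑' n : ℕ, z ^ n • C ((T ^ n) x)

variable (𝒳 𝒰 𝒴) in
/-- Data `{S, T, E, N, y}` such that the function `[E; N] (I - z T)⁻¹ x` is holomorphic on the unit
disk for every `x` (that is, its Taylor series at `0` converges on the disk) and such that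
`x ↦ F^S x`, `(F^S x)(z) = (E - S(z) N) (I - z T)⁻¹ x`, maps `𝒳` into `H(S)`. -/
structure AIPData where
  S : SchurFunction 𝒰 𝒴
  T : 𝒳 →L[ℂ] 𝒳
  E : 𝒳 →L[ℂ] 𝒴
  N : 𝒳 →L[ℂ] 𝒰
  y : 𝒳 →L[ℂ] ℂ
  holomorphic_E : ∀ x, ∀ z : 𝔻, Summable fun n : ℕ => (z : ℂ) ^ n • E ((T ^ n) x)
  holomorphic_N : ∀ x, ∀ z : 𝔻, Summable fun n : ℕ => (z : ℂ) ^ n • N ((T ^ n) x)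
  maps_into : ∀ x, ∃ f : H S, ∀ z : 𝔻, f z = obs E T x z - S z (obs N T x z)

namespace AIPData

variable (D : AIPData 𝒳 𝒰 𝒴)

/-- `(F^S x)(z) = (E - S(z) N) (I - z T)⁻¹ x`. -/
def FSfun (x : 𝒳) (z : 𝔻) : 𝒴 := obs D.E D.T x z - D.S z (obs D.N D.T x z)

theorem exists_clm_FSfun (z : 𝔻) : ∃ L : 𝒳 →L[ℂ] 𝒴, ∀ x, L x = D.FSfun x z := by
  let L : ℕ → 𝒳 →L[ℂ] 𝒴 := fun k =>
    ∑ n ∈ Finset.range k, (z : ℂ) ^ n • ((D.E - D.S z ∘L D.N) ∘L (D.T ^ n))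
  have hL : Filter.Tendsto (fun k x => L k x) Filter.atTop (nhds fun x => D.FSfun x z) := by
    rw [tendsto_pi_nhds]
    intro x
    have h1 := (D.holomorphic_E x z).hasSum.tendsto_sum_nat
    have h2 := (D.holomorphic_N x z).hasSum.tendsto_sum_nat
    have h3 := h1.sub (((D.S z).continuous.tendsto _).comp h2)
    refine h3.congr fun k => ?_
    simp [L, map_sum, smul_sub, Finset.sum_sub_distrib]
  exact ⟨continuousLinearMapOfTendsto L hL, fun x => rfl⟩

/-- `F^S` as a linear map into `H(S)`. -/
def FSlin : 𝒳 →ₗ[ℂ] H D.S where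
  toFun x := (D.maps_into x).choose
  map_add' x x' := by
    ext z
    obtain ⟨L, hL⟩ := D.exists_clm_FSfun z
    have h := fun x => (D.maps_into x).choose_spec z
    simp only [RKHS.coe_add, Pi.add_apply, h]
    have := L.map_add x x'
    rwa [hL, hL, hL] at this
  map_smul' c x := by
    ext z
    obtain ⟨L, hL⟩ := D.exists_clm_FSfun z
    have h := fun x => (D.maps_into x).choose_spec z
    simp only [RKHS.coe_smul, Pi.smul_apply, h, RingHom.id_apply]
    have := L.map_smul c x
    rwa [hL, hL] at this

theorem FSlin_apply (x : 𝒳) (z : 𝔻) : D.FSlin x z = D.FSfun x z :=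
  (D.maps_into x).choose_spec z

theorem isClosed_graph_FSlin : IsClosed (D.FSlin.graph : Set (𝒳 × H D.S)) := by
  have : (D.FSlin.graph : Set (𝒳 × H D.S)) = ⋂ z : 𝔻, {p | p.2 z = D.FSfun p.1 z} := by
    ext p
    simp only [SetLike.mem_coe, LinearMap.mem_graph_iff, Set.mem_iInter, Set.mem_ofPred_eq,
      ← FSlin_apply]
    exact ⟨fun h z => by rw [h], fun h => RKHS.ext h⟩
  rw [this]
  refine isClosed_iInter fun z => ?_
  obtain ⟨L, hL⟩ := D.exists_clm_FSfun z
  simp only [← hL]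
  exact isClosed_eq ((RKHS.continuous_eval z).comp continuous_snd) (L.continuous.comp continuous_fst)

/-- The operator `F^S : 𝒳 → H(S)`, bounded by the closed graph theorem. -/
def FS : 𝒳 →L[ℂ] H D.S := ContinuousLinearMap.ofIsClosedGraph D.isClosed_graph_FSlin

theorem FS_apply (x : 𝒳) (z : 𝔻) : D.FS x z = D.FSfun x z := D.FSlin_apply x z

/-- `P = (F^S)^{[*]} F^S`. -/
def P : 𝒳 →L[ℂ] 𝒳 := D.FS.adjoint ∘L D.FS

theorem P_nonneg : 0 ≤ D.P := by
  rw [ContinuousLinearMap.nonneg_iff_isPositive]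
  exact ContinuousLinearMap.isPositive_adjoint_comp_self D.FS

/-- The positive square root `P^{1/2}`. -/
def sqrtP : 𝒳 →L[ℂ] 𝒳 := CFC.sqrt D.P

theorem sqrtP_comp : D.sqrtP ∘L D.sqrtP = D.P := CFC.sqrt_mul_sqrt_self D.P D.P_nonneg

theorem norm_sqrtP (x : 𝒳) : ‖D.sqrtP x‖ = ‖D.FS x‖ := by
  have hs : D.sqrtP.adjoint = D.sqrtP :=
    (CFC.sqrt_nonneg D.P).isSelfAdjoint
  have : ⟪D.sqrtP x, D.sqrtP x⟫_ℂ = ⟪D.FS x, D.FS x⟫_ℂ := by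
    rw [← ContinuousLinearMap.adjoint_inner_left, ← ContinuousLinearMap.adjoint_inner_left, hs,
      ← ContinuousLinearMap.comp_apply, sqrtP_comp]
    rfl
  rw [@norm_eq_sqrt_re_inner ℂ, this, ← @norm_eq_sqrt_re_inner ℂ]

end AIPData

variable (𝒳 𝒰 𝒴) in
/-- An admissible data set: in addition, `P = (F^S)^{[*]} F^S` satisfies the Stein equation
`P - T^* P T = E^* E - N^* N`. -/
structure AdmissibleData extends AIPData 𝒳 𝒰 𝒴 where
  stein : toAIPData.P - T.adjoint ∘L toAIPData.P ∘L T = E.adjoint ∘L E - N.adjoint ∘L N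

namespace AdmissibleData

variable (D : AdmissibleData 𝒳 𝒰 𝒴)

/-- `f ∈ H(S)` solves the interpolation problem: `(F^S)^{[*]} f = y^*` and `‖f‖ ≤ 1`. -/
def IsSolution (f : H D.S) : Prop := D.FS.adjoint f = D.y.adjoint 1 ∧ ‖f‖ ≤ 1

/-- `X₀`, the closure of the range of `P^{1/2}`, i.e. `𝒳 ⊖ Ker P`. -/
abbrev X₀ : Submodule ℂ 𝒳 := D.sqrtP.range.topologicalClosure

/-- `P^{1/2}` as an operator into `X₀`. -/
def sqrtP₀ : 𝒳 →L[ℂ] D.X₀ :=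
  D.sqrtP.codRestrict D.X₀ fun x => D.sqrtP.range.le_topologicalClosure ⟨x, rfl⟩

/-- The column `[P^{1/2}; N]`. -/
def domCol : 𝒳 →L[ℂ] WithLp 2 (D.X₀ × 𝒰) :=
  (WithLp.prodContinuousLinearEquiv 2 ℂ D.X₀ 𝒰).symm.toContinuousLinearMap ∘L
    D.sqrtP₀.prod D.N

/-- The column `[P^{1/2} T; E]`. -/
def ranCol : 𝒳 →L[ℂ] WithLp 2 (D.X₀ × 𝒴) :=
  (WithLp.prodContinuousLinearEquiv 2 ℂ D.X₀ 𝒴).symm.toContinuousLinearMap ∘L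
    (D.sqrtP₀ ∘L D.T).prod D.E

/-- The domain `𝒟_V` of the isometry `V`. -/
abbrev domV : Submodule ℂ (WithLp 2 (D.X₀ × 𝒰)) := D.domCol.range.topologicalClosure

/-- The range `ℛ_V` of the isometry `V`. -/
abbrev ranV : Submodule ℂ (WithLp 2 (D.X₀ × 𝒴)) := D.ranCol.range.topologicalClosure

/-- The column `[P^{1/2}; N]` as an operator into `𝒟_V`. -/
def domCol' : 𝒳 →L[ℂ] D.domV :=
  D.domCol.codRestrict D.domV fun x => D.domCol.range.le_topologicalClosure ⟨x, rfl⟩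

/-- The isometry `V` determined by `V [P^{1/2} x; N x] = [P^{1/2} T x; E x]`, extended by continuity. -/
def V : D.domV →L[ℂ] WithLp 2 (D.X₀ × 𝒴) :=
  D.ranCol.toLinearMap.extendOfNorm D.domCol'.toLinearMap

theorem norm_ranCol (x : 𝒳) : ‖D.ranCol x‖ = ‖D.domCol x‖ := by
  have h := congrArg (fun A : 𝒳 →L[ℂ] 𝒳 => (⟪A x, x⟫_ℂ).re) D.stein
  simp only [sub_apply, ContinuousLinearMap.comp_apply, inner_sub_left,
    ContinuousLinearMap.adjoint_inner_left, AIPData.P, Complex.sub_re] at h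
  have e1 : ∀ w : 𝒴, (⟪w, w⟫_ℂ).re = ‖w‖ ^ 2 :=
    fun w => by simpa using @inner_self_eq_norm_sq ℂ _ _ _ _ w
  have e2 : ∀ w : 𝒰, (⟪w, w⟫_ℂ).re = ‖w‖ ^ 2 :=
    fun w => by simpa using @inner_self_eq_norm_sq ℂ _ _ _ _ w
  have e3 : ∀ w : H D.S, (⟪w, w⟫_ℂ).re = ‖w‖ ^ 2 :=
    fun w => by simpa using @inner_self_eq_norm_sq ℂ _ _ _ _ w
  rw [e1, e2, e3, e3, ← D.norm_sqrtP, ← D.norm_sqrtP] at h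
  have h1 : ‖D.ranCol x‖ ^ 2 = ‖D.sqrtP (D.T x)‖ ^ 2 + ‖D.E x‖ ^ 2 :=
    WithLp.prod_norm_sq_eq_of_L2 _
  have h2 : ‖D.domCol x‖ ^ 2 = ‖D.sqrtP x‖ ^ 2 + ‖D.N x‖ ^ 2 :=
    WithLp.prod_norm_sq_eq_of_L2 _
  rw [← sq_eq_sq₀ (norm_nonneg _) (norm_nonneg _), h1, h2]
  linarith

theorem denseRange_domCol' : DenseRange D.domCol' := by
  intro w
  rw [Metric.mem_closure_iff]
  intro ε hε
  obtain ⟨b, ⟨x, rfl⟩, hb⟩ := Metric.mem_closure_iff.mp w.2 ε hε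
  exact ⟨D.domCol' x, ⟨x, rfl⟩, hb⟩

theorem V_domCol' (x : 𝒳) : D.V (D.domCol' x) = D.ranCol x :=
  LinearMap.extendOfNorm_eq D.denseRange_domCol'
    ⟨1, fun x => by rw [one_mul]; exact (D.norm_ranCol x).le⟩ x

/-- The defect space `Δ = (X₀ ⊕ 𝒰) ⊖ 𝒟_V`. -/
abbrev Δ : Submodule ℂ (WithLp 2 (D.X₀ × 𝒰)) := D.domVᗮ

/-- The defect space `Δ_* = (X₀ ⊕ 𝒴) ⊖ ℛ_V`. -/
abbrev Δs : Submodule ℂ (WithLp 2 (D.X₀ × 𝒴)) := D.ranVᗮ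

section Redheffer

/-! `Δ'` and `Δs'` are the isomorphic copies `Δ̃`, `Δ̃_*` of `Δ`, `Δ_*`, identified by unitary maps
`i` and `is`. -/

variable {Δ' Δs' : Type*} [NormedAddCommGroup Δ'] [InnerProductSpace ℂ Δ']
  [NormedAddCommGroup Δs'] [InnerProductSpace ℂ Δs']
  (i : D.Δ ≃ₗᵢ[ℂ] Δ') (is : D.Δs ≃ₗᵢ[ℂ] Δs')

/-- The unitary colligation `U = [V 0 0; 0 0 i_*^*; 0 i 0]` from `dom V ⊕ Δ ⊕ Δ̃_* = X₀ ⊕ 𝒰 ⊕ Δ̃_*`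
onto `ran V ⊕ Δ_* ⊕ Δ̃ = X₀ ⊕ 𝒴 ⊕ Δ̃`. -/
def U : WithLp 2 (WithLp 2 (D.X₀ × 𝒰) × Δs') →L[ℂ] WithLp 2 (WithLp 2 (D.X₀ × 𝒴) × Δ') :=
  (WithLp.prodContinuousLinearEquiv 2 ℂ (WithLp 2 (D.X₀ × 𝒴)) Δ').symm.toContinuousLinearMap ∘L
    ContinuousLinearMap.prod
      (D.V ∘L D.domV.orthogonalProjectionOnto ∘L WithLp.fstL 2 ℂ _ Δs' +
        D.Δs.subtypeL ∘L (is.symm : Δs' →L[ℂ] D.Δs) ∘L WithLp.sndL 2 ℂ _ Δs')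
      ((i : D.Δ →L[ℂ] Δ') ∘L D.Δ.orthogonalProjectionOnto ∘L WithLp.fstL 2 ℂ _ Δs')

variable (Δs') in
/-- The inclusion of the summand `X₀ ⊕ 𝒰` into `X₀ ⊕ 𝒰 ⊕ Δ̃_*`. -/
def inXU : WithLp 2 (D.X₀ × 𝒰) →L[ℂ] WithLp 2 (WithLp 2 (D.X₀ × 𝒰) × Δs') :=
  (WithLp.prodContinuousLinearEquiv 2 ℂ (WithLp 2 (D.X₀ × 𝒰)) Δs').symm.toContinuousLinearMap ∘L
    ContinuousLinearMap.inl ℂ _ Δs'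

variable (Δs') in
/-- The inclusion of `X₀` into `X₀ ⊕ 𝒰 ⊕ Δ̃_*`. -/
def inX : D.X₀ →L[ℂ] WithLp 2 (WithLp 2 (D.X₀ × 𝒰) × Δs') :=
  D.inXU Δs' ∘L (WithLp.prodContinuousLinearEquiv 2 ℂ D.X₀ 𝒰).symm.toContinuousLinearMap ∘L
    ContinuousLinearMap.inl ℂ D.X₀ 𝒰

variable (Δs') in
/-- The inclusion of `𝒰` into `X₀ ⊕ 𝒰 ⊕ Δ̃_*`. -/
def inU : 𝒰 →L[ℂ] WithLp 2 (WithLp 2 (D.X₀ × 𝒰) × Δs') :=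
  D.inXU Δs' ∘L (WithLp.prodContinuousLinearEquiv 2 ℂ D.X₀ 𝒰).symm.toContinuousLinearMap ∘L
    ContinuousLinearMap.inr ℂ D.X₀ 𝒰

variable (Δs') in
/-- The inclusion of `Δ̃_*` into `X₀ ⊕ 𝒰 ⊕ Δ̃_*`. -/
def inΔs : Δs' →L[ℂ] WithLp 2 (WithLp 2 (D.X₀ × 𝒰) × Δs') :=
  (WithLp.prodContinuousLinearEquiv 2 ℂ (WithLp 2 (D.X₀ × 𝒰)) Δs').symm.toContinuousLinearMap ∘L
    ContinuousLinearMap.inr ℂ _ Δs'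

variable (Δ') in
/-- The projection of `X₀ ⊕ 𝒴 ⊕ Δ̃` onto `X₀`. -/
def outX : WithLp 2 (WithLp 2 (D.X₀ × 𝒴) × Δ') →L[ℂ] D.X₀ :=
  WithLp.fstL 2 ℂ D.X₀ 𝒴 ∘L WithLp.fstL 2 ℂ _ Δ'

variable (Δ') in
/-- The projection of `X₀ ⊕ 𝒴 ⊕ Δ̃` onto `𝒴`. -/
def outY : WithLp 2 (WithLp 2 (D.X₀ × 𝒴) × Δ') →L[ℂ] 𝒴 :=
  WithLp.sndL 2 ℂ D.X₀ 𝒴 ∘L WithLp.fstL 2 ℂ _ Δ'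

variable (Δ') in
/-- The projection of `X₀ ⊕ 𝒴 ⊕ Δ̃` onto `Δ̃`. -/
def outΔ : WithLp 2 (WithLp 2 (D.X₀ × 𝒴) × Δ') →L[ℂ] Δ' := WithLp.sndL 2 ℂ _ Δ'

/-! The blocks of `U = [A B₁ B₂; C₁ D₁₁ D₁₂; C₂ D₂₁ D₂₂]`. -/

def A : D.X₀ →L[ℂ] D.X₀ := D.outX Δ' ∘L D.U i is ∘L D.inX Δs'

def B₁ : 𝒰 →L[ℂ] D.X₀ := D.outX Δ' ∘L D.U i is ∘L D.inU Δs'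

def B₂ : Δs' →L[ℂ] D.X₀ := D.outX Δ' ∘L D.U i is ∘L D.inΔs Δs'

def C₁ : D.X₀ →L[ℂ] 𝒴 := D.outY Δ' ∘L D.U i is ∘L D.inX Δs'

def D₁₁ : 𝒰 →L[ℂ] 𝒴 := D.outY Δ' ∘L D.U i is ∘L D.inU Δs'

def D₁₂ : Δs' →L[ℂ] 𝒴 := D.outY Δ' ∘L D.U i is ∘L D.inΔs Δs'

def C₂ : D.X₀ →L[ℂ] Δ' := D.outΔ Δ' ∘L D.U i is ∘L D.inX Δs'

def D₂₁ : 𝒰 →L[ℂ] Δ' := D.outΔ Δ' ∘L D.U i is ∘L D.inU Δs'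

def D₂₂ : Δs' →L[ℂ] Δ' := D.outΔ Δ' ∘L D.U i is ∘L D.inΔs Δs'

theorem D₂₂_eq_zero : D.D₂₂ i is = 0 := by
  ext d
  simp [D₂₂, outΔ, inΔs, U]

/-- The resolvent `(I - z A)⁻¹`. -/
def res (z : ℂ) : D.X₀ →L[ℂ] D.X₀ := Ring.inverse (1 - z • D.A i is)

/-! The blocks of the characteristic function
`Σ(z) = [D₁₁ D₁₂; D₂₁ D₂₂] + z [C₁; C₂] (I - z A)⁻¹ [B₁ B₂]` of `U`. -/

def Sig₁₁ (z : ℂ) : 𝒰 →L[ℂ] 𝒴 := D.D₁₁ i is + z • (D.C₁ i is ∘L D.res i is z ∘L D.B₁ i is)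

def Sig₁₂ (z : ℂ) : Δs' →L[ℂ] 𝒴 := D.D₁₂ i is + z • (D.C₁ i is ∘L D.res i is z ∘L D.B₂ i is)

def Sig₂₁ (z : ℂ) : 𝒰 →L[ℂ] Δ' := D.D₂₁ i is + z • (D.C₂ i is ∘L D.res i is z ∘L D.B₁ i is)

def Sig₂₂ (z : ℂ) : Δs' →L[ℂ] Δ' := D.D₂₂ i is + z • (D.C₂ i is ∘L D.res i is z ∘L D.B₂ i is)

variable (ℰ : SchurFunction Δ' Δs')

/-- `G = Σ₁₂ (I - ℰ Σ₂₂)⁻¹`. -/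
def G (z : ℂ) : Δs' →L[ℂ] 𝒴 := D.Sig₁₂ i is z ∘L Ring.inverse (1 - ℰ z ∘L D.Sig₂₂ i is z)

/-- `Γ = (C₁ + G ℰ C₂) (I - z A)⁻¹`. -/
def Γ (z : ℂ) : D.X₀ →L[ℂ] 𝒴 :=
  (D.C₁ i is + D.G i is ℰ z ∘L ℰ z ∘L D.C₂ i is) ∘L D.res i is z

/-- The Redheffer transform `R_Σ[ℰ] = Σ₁₁ + Σ₁₂ (I - ℰ Σ₂₂)⁻¹ ℰ Σ₂₁`. -/
def redheffer (z : ℂ) : 𝒰 →L[ℂ] 𝒴 :=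
  D.Sig₁₁ i is z + D.Sig₁₂ i is z ∘L Ring.inverse (1 - ℰ z ∘L D.Sig₂₂ i is z) ∘L
    ℰ z ∘L D.Sig₂₁ i is z

/-- `S = R_Σ[ℰ]` on the unit disk. -/
def IsRedhefferParameter : Prop := ∀ z : 𝔻, D.S z = D.redheffer i is ℰ z

end Redheffer

end AdmissibleData

end Interpolation

end DBR

end

noncomputable section

namespace DBR

section Generic

theorem exists_contraction_of_inner_eq {ι E F : Type*}
    [NormedAddCommGroup E] [InnerProductSpace ℂ E] [CompleteSpace E]
    [NormedAddCommGroup F] [InnerProductSpace ℂ F] [CompleteSpace F]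
    (a : ι → E) (b : ι → F) (h : ∀ k l, ⟪a k, a l⟫_ℂ = ⟪b k, b l⟫_ℂ) :
    ∃ T : E →L[ℂ] F, (∀ k, T (a k) = b k) ∧ (∀ x, ‖T x‖ ≤ ‖x‖) ∧
      ∀ x ∈ (Submodule.span ℂ (Set.range a)).topologicalClosure, ‖T x‖ = ‖x‖ := by
  set p := (Submodule.span ℂ (Set.range a)).topologicalClosure
  have hpc : IsClosed (p : Set E) := Submodule.isClosed_topologicalClosure _
  have : CompleteSpace p := hpc.completeSpace_coe
  have hmem : ∀ c : ι →₀ ℂ, Finsupp.linearCombination ℂ a c ∈ p := fun c =>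
    Submodule.le_topologicalClosure _ (Finsupp.range_linearCombination ℂ (v := a) ▸ ⟨c, rfl⟩)
  let e : (ι →₀ ℂ) →ₗ[ℂ] p := (Finsupp.linearCombination ℂ a).codRestrict p hmem
  let f : (ι →₀ ℂ) →ₗ[ℂ] F := Finsupp.linearCombination ℂ b
  have hnorm : ∀ c, ‖f c‖ = ‖e c‖ := by
    intro c
    have : ⟪f c, f c⟫_ℂ = ⟪(e c : E), (e c : E)⟫_ℂ := by
      simp only [f, e, LinearMap.codRestrict_apply, Finsupp.linearCombination_apply, Finsupp.sum,
        sum_inner, inner_sum, inner_smul_left, inner_smul_right, h]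
    rw [@norm_eq_sqrt_re_inner ℂ, this, ← @norm_eq_sqrt_re_inner ℂ, Submodule.coe_norm]
  have hdense : DenseRange e := by
    intro w
    rw [Metric.mem_closure_iff]
    intro ε hε
    obtain ⟨b, hb, hd⟩ := Metric.mem_closure_iff.mp w.2 ε hε
    obtain ⟨c, rfl⟩ : b ∈ (Finsupp.linearCombination ℂ a).range := by
      rw [Finsupp.range_linearCombination]; exact hb
    exact ⟨e c, ⟨c, rfl⟩, hd⟩
  let T₀ : p →L[ℂ] F := f.extendOfNorm e
  have hT₀ : ∀ c, T₀ (e c) = f c := fun c =>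
    LinearMap.extendOfNorm_eq hdense ⟨1, fun x => by rw [one_mul]; exact (hnorm x).le⟩ c
  have hT₀n : ∀ x, ‖T₀ x‖ = ‖x‖ := by
    intro x
    refine hdense.induction_on (p := fun x => ‖T₀ x‖ = ‖x‖) x
      (isClosed_eq (by fun_prop) (by fun_prop)) fun c => ?_
    rw [hT₀, hnorm]
  refine ⟨T₀ ∘L p.orthogonalProjectionOnto, fun k => ?_, fun x => ?_, fun x hx => ?_⟩
  · have : a k = e (Finsupp.single k 1) := by simp [e]
    rw [ContinuousLinearMap.comp_apply, this, Submodule.orthogonalProjectionOnto_mem_subspace_eq_self,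
      hT₀]
    simp [f]
  · rw [ContinuousLinearMap.comp_apply, hT₀n]
    exact Submodule.norm_orthogonalProjectionOnto_apply_le p x
  · rw [ContinuousLinearMap.comp_apply, hT₀n]
    exact congrArg norm (Submodule.starProjection_eq_self_iff.mpr hx)

section Transfer

variable {K E F : Type*} [NormedAddCommGroup K] [InnerProductSpace ℂ K] [CompleteSpace K]
  [NormedAddCommGroup E] [InnerProductSpace ℂ E]
  [NormedAddCommGroup F] [InnerProductSpace ℂ F]

theorem isUnit_one_sub_smul {A : K →L[ℂ] K} (hA : ∀ x, ‖A x‖ ≤ ‖x‖) {z : ℂ} (hz : ‖z‖ < 1) :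
    IsUnit (1 - z • A) := by
  refine isUnit_one_sub_of_norm_lt_one ?_
  have : ‖A‖ ≤ 1 := A.opNorm_le_bound zero_le_one (by simpa using hA)
  rw [norm_smul]
  nlinarith [norm_nonneg z, norm_nonneg A]

omit [CompleteSpace K] in
theorem inverse_eq_iff {R : K →L[ℂ] K} (hR : IsUnit R) {x y : K} :
    Ring.inverse R x = y ↔ x = R y := by
  constructor
  · rintro rfl
    rw [← mul_apply_eq_comp, Ring.mul_inverse_cancel _ hR]; rfl
  · rintro rfl
    rw [← mul_apply_eq_comp, Ring.inverse_mul_cancel _ hR]; rfl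

/-- The transfer function `D + z C (I - z A)⁻¹ B`. -/
def transfer (A : K →L[ℂ] K) (B : E →L[ℂ] K) (C : K →L[ℂ] F) (D : E →L[ℂ] F) (z : ℂ) :
    E →L[ℂ] F := D + z • (C ∘L Ring.inverse (1 - z • A) ∘L B)

variable {A : K →L[ℂ] K} {B : E →L[ℂ] K} {C : K →L[ℂ] F} {D : E →L[ℂ] F}

theorem transfer_apply_of_eq (hA : ∀ x, ‖A x‖ ≤ ‖x‖) {z : ℂ} (hz : ‖z‖ < 1) {x : K} {u : E}
    {y : F} (hx : A (z • x) + B u = x) (hy : C (z • x) + D u = y) : transfer A B C D z u = y := by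
  have h : Ring.inverse (1 - z • A) (B u) = x := by
    rw [inverse_eq_iff (isUnit_one_sub_smul hA hz)]
    simp only [sub_apply, one_apply_eq_self, smul_apply, ← map_smul]
    exact eq_sub_of_add_eq' hx
  simp [transfer, h, ← hy, add_comm]

theorem exists_state (hA : ∀ x, ‖A x‖ ≤ ‖x‖) {z : ℂ} (hz : ‖z‖ < 1) (u : E) :
    ∃ x, A (z • x) + B u = x := by
  refine ⟨Ring.inverse (1 - z • A) (B u), ?_⟩
  have := (inverse_eq_iff (isUnit_one_sub_smul hA hz) (x := B u)).mp rfl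
  simp only [sub_apply, one_apply_eq_self, smul_apply] at this
  rw [map_smul]
  exact (eq_add_of_sub_eq' this.symm).symm

theorem differentiableOn_transfer (hA : ∀ x, ‖A x‖ ≤ ‖x‖) :
    DifferentiableOn ℂ (transfer A B C D) (Metric.ball 0 1) := by
  have h1 : DifferentiableOn ℂ (fun z : ℂ => Ring.inverse (1 - z • A)) (Metric.ball 0 1) := by
    intro z hz
    have hu := isUnit_one_sub_smul hA (by simpa using hz : ‖z‖ < 1)
    obtain ⟨R, hR⟩ := hu
    refine DifferentiableAt.differentiableWithinAt ?_
    have h2 : DifferentiableAt ℂ (Ring.inverse : (K →L[ℂ] K) → _) (1 - z • A) := by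
      rw [← hR]; exact differentiableAt_inverse R.isUnit
    have h3 : DifferentiableAt ℂ (fun w : ℂ => 1 - w • A) z := by fun_prop
    exact DifferentiableAt.comp z h2 h3
  unfold transfer
  refine DifferentiableOn.fun_add (differentiableOn_const _) (DifferentiableOn.fun_smul differentiableOn_id ?_)
  exact (differentiableOn_const _).clm_comp (h1.clm_comp (differentiableOn_const _))

omit [CompleteSpace K] in
theorem norm_le_of_colligation
    (hM : ∀ x u, ‖A x + B u‖ ^ 2 + ‖C x + D u‖ ^ 2 ≤ ‖x‖ ^ 2 + ‖u‖ ^ 2) (x : K) : ‖A x‖ ≤ ‖x‖ := by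
  have := hM x 0
  simp only [map_zero, add_zero, norm_zero] at this
  refine le_of_sq_le_sq ?_ (norm_nonneg _)
  linarith [sq_nonneg ‖C x‖]

theorem norm_transfer_le (hM : ∀ x u, ‖A x + B u‖ ^ 2 + ‖C x + D u‖ ^ 2 ≤ ‖x‖ ^ 2 + ‖u‖ ^ 2)
    {z : ℂ} (hz : ‖z‖ < 1) : ‖transfer A B C D z‖ ≤ 1 := by
  have hA : ∀ x, ‖A x‖ ≤ ‖x‖ := norm_le_of_colligation hM
  refine ContinuousLinearMap.opNorm_le_bound _ zero_le_one fun u => ?_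
  obtain ⟨x, hx⟩ := exists_state (B := B) hA hz u
  rw [transfer_apply_of_eq (C := C) (D := D) hA hz hx rfl, one_mul]
  have := hM (z • x) u
  rw [hx, norm_smul] at this
  have h3 : (‖z‖ * ‖x‖) ^ 2 ≤ ‖x‖ ^ 2 := by
    gcongr
    nlinarith [norm_nonneg x]
  exact le_of_sq_le_sq (by linarith) (norm_nonneg _)

/-- The transfer function of a contractive colligation, as a Schur-class function. -/
def transferSchur (A : K →L[ℂ] K) (B : E →L[ℂ] K) (C : K →L[ℂ] F) (D : E →L[ℂ] F)
    (hM : ∀ x u, ‖A x + B u‖ ^ 2 + ‖C x + D u‖ ^ 2 ≤ ‖x‖ ^ 2 + ‖u‖ ^ 2) :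
    SchurFunction E F where
  toFun := transfer A B C D
  differentiableOn := differentiableOn_transfer (norm_le_of_colligation hM)
  norm_le_one z hz := norm_transfer_le hM (by simpa using hz)

theorem norm_transfer_le_norm
    (hM : ∀ x u, ‖A x + B u‖ ^ 2 + ‖C x + D u‖ ^ 2 ≤ ‖x‖ ^ 2 + ‖u‖ ^ 2) (hD : D = 0)
    {z : ℂ} (hz : ‖z‖ < 1) : ‖transfer A B C D z‖ ≤ ‖z‖ := by
  have h0 : transfer A B C D 0 = 0 := by simp [transfer, hD]
  refine Complex.norm_le_norm_of_mapsTo_ball (R := 1) (transferSchur A B C D hM).differentiableOn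
    (fun w hw => ?_) h0 hz
  simpa using norm_transfer_le hM (by simpa using hw)

end Transfer

end Generic

theorem one_sub_mul_conj_ne_zero (z ζ : 𝔻) : (1 : ℂ) - z * conj (ζ : ℂ) ≠ 0 := by
  intro h
  have h2 : ‖(z : ℂ) * conj (ζ : ℂ)‖ = 1 := by rw [← sub_eq_zero.mp h, norm_one]
  rw [norm_mul, RCLike.norm_conj] at h2
  nlinarith [norm_nonneg (z : ℂ), norm_nonneg (ζ : ℂ), z.norm_lt_one, ζ.norm_lt_one]

theorem inner_kerFun_H {E F : Type*}
    [NormedAddCommGroup E] [InnerProductSpace ℂ E] [CompleteSpace E]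
    [NormedAddCommGroup F] [InnerProductSpace ℂ F] [CompleteSpace F]
    (S : SchurFunction E F) (z ζ : 𝔻) (v w : F) :
    (1 - (z : ℂ) * conj (ζ : ℂ)) * ⟪RKHS.kerFun (H S) z v, RKHS.kerFun (H S) ζ w⟫_ℂ =
      ⟪v, w⟫_ℂ - ⟪(S z).adjoint v, (S ζ).adjoint w⟫_ℂ := by
  rw [RKHS.kerFun_inner, RKHS.kerFun_apply, RKHS.OfKernel.kernel_ofKernel]
  simp only [dbrKernel, Matrix.of_apply, smul_apply, sub_apply, one_apply_eq_self,
    ContinuousLinearMap.comp_apply, inner_smul_right, inner_sub_right,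
    ContinuousLinearMap.adjoint_inner_left]
  rw [mul_inv_cancel_left₀ (one_sub_mul_conj_ne_zero z ζ)]

namespace AdmissibleData

variable {𝒳 𝒰 𝒴 : Type*}
  [NormedAddCommGroup 𝒳] [InnerProductSpace ℂ 𝒳] [CompleteSpace 𝒳]
  [NormedAddCommGroup 𝒰] [InnerProductSpace ℂ 𝒰] [CompleteSpace 𝒰]
  [NormedAddCommGroup 𝒴] [InnerProductSpace ℂ 𝒴] [CompleteSpace 𝒴]
  (D : AdmissibleData 𝒳 𝒰 𝒴)

instance : CompleteSpace D.X₀ := (Submodule.isClosed_topologicalClosure _).completeSpace_coe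

instance : CompleteSpace D.domV := (Submodule.isClosed_topologicalClosure _).completeSpace_coe

instance : CompleteSpace D.ranV := (Submodule.isClosed_topologicalClosure _).completeSpace_coe

theorem norm_V (w : D.domV) : ‖D.V w‖ = ‖w‖ := by
  refine D.denseRange_domCol'.induction_on (p := fun w => ‖D.V w‖ = ‖w‖) w
    (isClosed_eq (by fun_prop) (by fun_prop)) fun x => ?_
  rw [V_domCol', norm_ranCol]
  rfl

theorem V_mem_ranV (w : D.domV) : D.V w ∈ D.ranV := by
  refine D.denseRange_domCol'.induction_on (p := fun w => D.V w ∈ D.ranV) w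
    ((Submodule.isClosed_topologicalClosure _).preimage D.V.continuous) fun x => ?_
  rw [V_domCol']
  exact D.ranCol.range.le_topologicalClosure ⟨x, rfl⟩

theorem exists_V_eq {r : WithLp 2 (D.X₀ × 𝒴)} (hr : r ∈ D.ranV) : ∃ w, D.V w = r := by
  have hV : Isometry D.V := AddMonoidHomClass.isometry_of_norm _ D.norm_V
  have hc : IsClosed (Set.range D.V) := hV.isClosedEmbedding.isClosed_range
  have : (D.ranV : Set (WithLp 2 (D.X₀ × 𝒴))) ⊆ Set.range D.V := by
    refine closure_minimal ?_ hc
    rintro _ ⟨x, rfl⟩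
    exact ⟨D.domCol' x, D.V_domCol' x⟩
  exact this hr

variable {Δ' Δs' : Type*} [NormedAddCommGroup Δ'] [InnerProductSpace ℂ Δ']
  [NormedAddCommGroup Δs'] [InnerProductSpace ℂ Δs']
  (i : D.Δ ≃ₗᵢ[ℂ] Δ') (is : D.Δs ≃ₗᵢ[ℂ] Δs')

theorem U_toLp (w : WithLp 2 (D.X₀ × 𝒰)) (d : Δs') : D.U i is (WithLp.toLp 2 (w, d)) =
    WithLp.toLp 2 (D.V (D.domV.orthogonalProjectionOnto w) + (is.symm d : WithLp 2 (D.X₀ × 𝒴)),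
      i (D.Δ.orthogonalProjectionOnto w)) := rfl

theorem U_toLp_add (p : D.domV) (q : D.Δ) (d : Δs') :
    D.U i is (WithLp.toLp 2 ((p + q : WithLp 2 (D.X₀ × 𝒰)), d)) =
      WithLp.toLp 2 (D.V p + (is.symm d : WithLp 2 (D.X₀ × 𝒴)), i q) := by
  have h1 : D.domV.orthogonalProjectionOnto (p + q : WithLp 2 (D.X₀ × 𝒰)) = p := by
    rw [map_add, Submodule.orthogonalProjectionOnto_mem_subspace_eq_self,
      Submodule.orthogonalProjectionOnto_apply_of_mem_orthogonal q.2, add_zero]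
  have h2 : D.Δ.orthogonalProjectionOnto (p + q : WithLp 2 (D.X₀ × 𝒰)) = q := by
    rw [map_add, Submodule.orthogonalProjectionOnto_mem_subspace_eq_self,
      Submodule.orthogonalProjectionOnto_apply_of_mem_orthogonal
        (Submodule.le_orthogonal_orthogonal _ p.2), zero_add]
  rw [U_toLp, h1, h2]

theorem exists_eq_add (w : WithLp 2 (D.X₀ × 𝒰)) : ∃ (p : D.domV) (q : D.Δ),
    w = (p + q : WithLp 2 (D.X₀ × 𝒰)) :=
  ⟨D.domV.orthogonalProjectionOnto w, D.Δ.orthogonalProjectionOnto w,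
    (Submodule.starProjection_add_starProjection_orthogonal (K := D.domV) w).symm⟩

theorem norm_U (w : WithLp 2 (WithLp 2 (D.X₀ × 𝒰) × Δs')) : ‖D.U i is w‖ = ‖w‖ := by
  obtain ⟨w, d⟩ := w
  obtain ⟨p, q, rfl⟩ := D.exists_eq_add w
  rw [D.U_toLp_add, ← sq_eq_sq₀ (norm_nonneg _) (norm_nonneg _)]
  have h1 := norm_add_sq_eq_norm_sq_add_norm_sq_of_inner_eq_zero (𝕜 := ℂ) (p : WithLp 2 (D.X₀ × 𝒰)) q
    (q.2 _ p.2)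
  have h2 := norm_add_sq_eq_norm_sq_add_norm_sq_of_inner_eq_zero (𝕜 := ℂ) (D.V p)
    (is.symm d : WithLp 2 (D.X₀ × 𝒴)) ((is.symm d).2 _ (D.V_mem_ranV p))
  have h3 := D.norm_V p
  have h4 : ‖((is.symm d : D.Δs) : WithLp 2 (D.X₀ × 𝒴))‖ = ‖d‖ := is.symm.norm_map d
  have h5 : ‖((p : D.domV) : WithLp 2 (D.X₀ × 𝒰))‖ = ‖p‖ := rfl
  have h6 : ‖((q : D.Δ) : WithLp 2 (D.X₀ × 𝒰))‖ = ‖q‖ := rfl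
  have h7 := i.norm_map q
  have h8 := WithLp.prod_norm_sq_eq_of_L2
    (WithLp.toLp 2 (D.V p + (is.symm d : WithLp 2 (D.X₀ × 𝒴)), i q))
  have h9 := WithLp.prod_norm_sq_eq_of_L2
    (WithLp.toLp 2 ((p + q : WithLp 2 (D.X₀ × 𝒰)), d))
  change _ = ‖D.V p + (is.symm d : WithLp 2 (D.X₀ × 𝒴))‖ ^ 2 + ‖i q‖ ^ 2 at h8
  change _ = ‖(p + q : WithLp 2 (D.X₀ × 𝒰))‖ ^ 2 + ‖d‖ ^ 2 at h9
  rw [h7] at h8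
  rw [h3, h4] at h2
  rw [h5, h6] at h1
  nlinarith

theorem U_surjective : Function.Surjective (D.U i is) := by
  rintro ⟨r, e⟩
  obtain ⟨p, hp⟩ := D.exists_V_eq (D.ranV.orthogonalProjectionOnto r).2
  refine ⟨WithLp.toLp 2 ((p + (i.symm e : D.Δ) : WithLp 2 (D.X₀ × 𝒰)),
    is (D.Δs.orthogonalProjectionOnto r)), ?_⟩
  rw [D.U_toLp_add, hp, LinearIsometryEquiv.symm_apply_apply, LinearIsometryEquiv.apply_symm_apply]
  congr 2
  exact Submodule.starProjection_add_starProjection_orthogonal (K := D.ranV) r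

theorem inner_adjoint_U [CompleteSpace Δ'] [CompleteSpace Δs']
    (a b : WithLp 2 (WithLp 2 (D.X₀ × 𝒴) × Δ')) :
    ⟪(D.U i is).adjoint a, (D.U i is).adjoint b⟫_ℂ = ⟪a, b⟫_ℂ := by
  obtain ⟨b, rfl⟩ := D.U_surjective i is b
  rw [ContinuousLinearMap.adjoint_inner_left]
  congr 1
  have : (D.U i is).adjoint ∘L D.U i is = 1 :=
    (ContinuousLinearMap.norm_map_iff_adjoint_comp_self _).mp (D.norm_U i is)
  exact congrArg (D.U i is) (DFunLike.congr_fun this b)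

theorem U_apply (x : D.X₀) (u : 𝒰) (d : Δs') :
    D.U i is (WithLp.toLp 2 (WithLp.toLp 2 (x, u), d)) =
      WithLp.toLp 2 (WithLp.toLp 2 (D.A i is x + D.B₁ i is u + D.B₂ i is d,
        D.C₁ i is x + D.D₁₁ i is u + D.D₁₂ i is d),
        D.C₂ i is x + D.D₂₁ i is u + D.D₂₂ i is d) := by
  have : (WithLp.toLp 2 (WithLp.toLp 2 (x, u), d) : WithLp 2 (WithLp 2 (D.X₀ × 𝒰) × Δs')) =
      D.inX Δs' x + D.inU Δs' u + D.inΔs Δs' d := by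
    simp [inX, inU, inΔs, inXU, ← WithLp.toLp_add]
  rw [this]
  simp only [A, B₁, B₂, C₁, C₂, D₁₁, D₁₂, D₂₁, D₂₂, ContinuousLinearMap.comp_apply, ← map_add]
  rfl

theorem norm_blocks (x : D.X₀) (u : 𝒰) (d : Δs') :
    ‖D.A i is x + D.B₁ i is u + D.B₂ i is d‖ ^ 2 +
      ‖D.C₁ i is x + D.D₁₁ i is u + D.D₁₂ i is d‖ ^ 2 +
      ‖D.C₂ i is x + D.D₂₁ i is u + D.D₂₂ i is d‖ ^ 2 = ‖x‖ ^ 2 + ‖u‖ ^ 2 + ‖d‖ ^ 2 := by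
  have h := congrArg (· ^ 2) (D.norm_U i is (WithLp.toLp 2 (WithLp.toLp 2 (x, u), d)))
  rw [D.U_apply] at h
  simp only [WithLp.prod_norm_sq_eq_of_L2] at h
  exact h

theorem norm_A_le (x : D.X₀) : ‖D.A i is x‖ ≤ ‖x‖ := by
  have := D.norm_blocks i is x 0 0
  simp only [map_zero, add_zero, norm_zero] at this
  refine le_of_sq_le_sq ?_ (norm_nonneg _)
  nlinarith [sq_nonneg ‖D.C₁ i is x‖, sq_nonneg ‖D.C₂ i is x‖]

theorem isUnit_one_sub_A {z : ℂ} (hz : ‖z‖ < 1) : IsUnit (1 - z • D.A i is) :=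
  isUnit_one_sub_smul (D.norm_A_le i is) hz

theorem norm_Sig₂₂_le {z : ℂ} (hz : ‖z‖ < 1) : ‖D.Sig₂₂ i is z‖ ≤ ‖z‖ := by
  refine norm_transfer_le_norm (fun x d => ?_) (D.D₂₂_eq_zero i is) hz
  have := D.norm_blocks i is x 0 d
  simp only [map_zero, add_zero, norm_zero] at this
  nlinarith [sq_nonneg ‖D.C₁ i is x + D.D₁₂ i is d‖]

variable (ℰ : SchurFunction Δ' Δs')

theorem isUnit_one_sub_Sig₂₂ [CompleteSpace Δs'] {z : ℂ} (hz : ‖z‖ < 1) :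
    IsUnit (1 - ℰ z ∘L D.Sig₂₂ i is z) := by
  refine isUnit_one_sub_of_norm_lt_one ?_
  have h1 := ℰ.norm_le_one z (by simpa using hz)
  have h2 := D.norm_Sig₂₂_le i is hz
  have h3 := (ℰ z).opNorm_comp_le (D.Sig₂₂ i is z)
  nlinarith [norm_nonneg (ℰ z), norm_nonneg (D.Sig₂₂ i is z), norm_nonneg z]

theorem res_apply_sub {z : ℂ} (hz : ‖z‖ < 1) (x : D.X₀) :
    D.res i is z (x - z • D.A i is x) = x := by
  rw [res, inverse_eq_iff (D.isUnit_one_sub_A i is hz)]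
  rfl

theorem G_apply_sub [CompleteSpace Δs'] {z : ℂ} (hz : ‖z‖ < 1) (d : Δs') :
    D.G i is ℰ z (d - ℰ z (D.Sig₂₂ i is z d)) = D.Sig₁₂ i is z d := by
  rw [G, ContinuousLinearMap.comp_apply]
  congr 1
  rw [inverse_eq_iff (D.isUnit_one_sub_Sig₂₂ i is ℰ hz)]
  rfl

theorem redheffer_apply (z : ℂ) (u : 𝒰) : D.redheffer i is ℰ z u =
    D.Sig₁₁ i is z u + D.G i is ℰ z (ℰ z (D.Sig₂₁ i is z u)) := rfl

theorem Γ_apply (z : ℂ) (x : D.X₀) : D.Γ i is ℰ z x =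
    D.C₁ i is (D.res i is z x) + D.G i is ℰ z (ℰ z (D.C₂ i is (D.res i is z x))) := rfl

theorem row_identity_X {z : ℂ} (hz : ‖z‖ < 1) (x : D.X₀) :
    z • D.Γ i is ℰ z (D.A i is x) + D.C₁ i is x + D.G i is ℰ z (ℰ z (D.C₂ i is x)) =
      D.Γ i is ℰ z x := by
  have h : D.Γ i is ℰ z (x - z • D.A i is x) =
      D.C₁ i is x + D.G i is ℰ z (ℰ z (D.C₂ i is x)) := by
    rw [Γ_apply, D.res_apply_sub i is hz]
  rw [map_sub, map_smul] at h
  rw [add_assoc, ← h]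
  abel

theorem row_identity_U (z : ℂ) (u : 𝒰) :
    z • D.Γ i is ℰ z (D.B₁ i is u) + D.D₁₁ i is u + D.G i is ℰ z (ℰ z (D.D₂₁ i is u)) =
      D.redheffer i is ℰ z u := by
  rw [redheffer_apply, Γ_apply]
  simp only [Sig₁₁, Sig₂₁, add_apply, smul_apply, ContinuousLinearMap.comp_apply, map_add, map_smul,
    smul_add]
  abel

theorem row_identity_Δ [CompleteSpace Δs'] {z : ℂ} (hz : ‖z‖ < 1) (d : Δs') :
    z • D.Γ i is ℰ z (D.B₂ i is d) + D.D₁₂ i is d + D.G i is ℰ z (ℰ z (D.D₂₂ i is d)) =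
      D.G i is ℰ z d := by
  have h := D.G_apply_sub i is ℰ hz d
  rw [map_sub, sub_eq_iff_eq_add] at h
  rw [h, Γ_apply]
  simp only [Sig₁₂, Sig₂₂, add_apply, smul_apply, ContinuousLinearMap.comp_apply, map_add, map_smul,
    smul_add]
  abel

variable [CompleteSpace Δ'] [CompleteSpace Δs']

theorem adjoint_U_row {z : ℂ} (hz : ‖z‖ < 1) (v : 𝒴) :
    (D.U i is).adjoint (WithLp.toLp 2 (WithLp.toLp 2 (conj z • (D.Γ i is ℰ z).adjoint v, v),
      (ℰ z).adjoint ((D.G i is ℰ z).adjoint v))) =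
    WithLp.toLp 2 (WithLp.toLp 2 ((D.Γ i is ℰ z).adjoint v, (D.redheffer i is ℰ z).adjoint v),
      (D.G i is ℰ z).adjoint v) := by
  refine ext_inner_right ℂ fun w => ?_
  obtain ⟨⟨x, u⟩, d⟩ := w
  rw [ContinuousLinearMap.adjoint_inner_left, U_apply]
  simp only [WithLp.prod_inner_apply, ContinuousLinearMap.adjoint_inner_left, inner_smul_left,
    ← D.row_identity_X i is ℰ hz x, ← D.row_identity_U i is ℰ z u, ← D.row_identity_Δ i is ℰ hz d,
    inner_add_right, inner_smul_right, Complex.conj_conj]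
  ring

/-- The kernel decomposition `K_S = Γ Γ^* + G K_ℰ G^*`, in inner-product form. -/
theorem inner_kerFun_eq (h : D.IsRedhefferParameter i is ℰ) (z ζ : 𝔻) (v w : 𝒴) :
    ⟪RKHS.kerFun (H D.S) z v, RKHS.kerFun (H D.S) ζ w⟫_ℂ =
      ⟪(D.Γ i is ℰ z).adjoint v, (D.Γ i is ℰ ζ).adjoint w⟫_ℂ +
      ⟪RKHS.kerFun (H ℰ) z ((D.G i is ℰ z).adjoint v),
        RKHS.kerFun (H ℰ) ζ ((D.G i is ℰ ζ).adjoint w)⟫_ℂ := by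
  refine mul_left_cancel₀ (one_sub_mul_conj_ne_zero z ζ) ?_
  rw [mul_add, inner_kerFun_H, inner_kerFun_H, h z, h ζ]
  have key := D.inner_adjoint_U i is
    (WithLp.toLp 2 (WithLp.toLp 2 (conj (z : ℂ) • (D.Γ i is ℰ z).adjoint v, v),
      (ℰ z).adjoint ((D.G i is ℰ z).adjoint v)))
    (WithLp.toLp 2 (WithLp.toLp 2 (conj (ζ : ℂ) • (D.Γ i is ℰ ζ).adjoint w, w),
      (ℰ ζ).adjoint ((D.G i is ℰ ζ).adjoint w)))
  rw [D.adjoint_U_row i is ℰ z.norm_lt_one, D.adjoint_U_row i is ℰ ζ.norm_lt_one] at key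
  simp only [WithLp.prod_inner_apply, inner_smul_left, inner_smul_right, Complex.conj_conj] at key
  linear_combination -key

end AdmissibleData

section PartialIsometry

open ContinuousLinearMap

variable {X K L : Type*}
  [NormedAddCommGroup X] [InnerProductSpace ℂ X] [CompleteSpace X]
  [NormedAddCommGroup K] [InnerProductSpace ℂ K] [CompleteSpace K]
  [NormedAddCommGroup L] [InnerProductSpace ℂ L] [CompleteSpace L]
  {M : X →L[ℂ] L} {N : K →L[ℂ] L}

theorem adjoint_apply_eq_zero_of_complementary (hM : ∀ x, M.adjoint (M x) = x)
    (hMN : ∀ f, M (M.adjoint f) + N (N.adjoint f) = f) (k : K) : M.adjoint (N k) = 0 := by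
  have h1 : ∀ x, N.adjoint (M x) = 0 := fun x => by
    have h2 := hMN (M x)
    rw [hM, add_eq_left] at h2
    rw [← inner_self_eq_zero (𝕜 := ℂ), adjoint_inner_left, h2, inner_zero_right]
  refine ext_inner_right ℂ fun x => ?_
  rw [adjoint_inner_left, ← adjoint_inner_right, h1, inner_zero_right, inner_zero_left]

theorem norm_add_sq_of_complementary (hM : ∀ x, M.adjoint (M x) = x)
    (hMN : ∀ f, M (M.adjoint f) + N (N.adjoint f) = f) (x : X) (k : K) :
    ‖M x + N k‖ ^ 2 = ‖x‖ ^ 2 + ‖N k‖ ^ 2 := by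
  have h0 : ⟪M x, N k⟫_ℂ = 0 := by
    rw [← adjoint_inner_right, adjoint_apply_eq_zero_of_complementary hM hMN, inner_zero_right]
  have hn : ‖M x‖ = ‖x‖ := by
    rw [@norm_eq_sqrt_re_inner ℂ, ← adjoint_inner_left, hM, ← @norm_eq_sqrt_re_inner ℂ]
  have := norm_add_sq_eq_norm_sq_add_norm_sq_of_inner_eq_zero _ _ h0
  rw [hn] at this
  linarith

theorem apply_adjoint_apply_of_complementary (hM : ∀ x, M.adjoint (M x) = x)
    (hMN : ∀ f, M (M.adjoint f) + N (N.adjoint f) = f) (k : K) : N (N.adjoint (N k)) = N k := by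
  have := hMN (N k)
  rwa [adjoint_apply_eq_zero_of_complementary hM hMN, map_zero, zero_add] at this

theorem starProjection_ker_orthogonal_of_complementary (hM : ∀ x, M.adjoint (M x) = x)
    (hMN : ∀ f, M (M.adjoint f) + N (N.adjoint f) = f) (k : K) :
    N.kerᗮ.starProjection k = N.adjoint (N k) := by
  refine Submodule.eq_starProjection_of_mem_orthogonal (K := N.kerᗮ) ?_ ?_
  · intro w hw
    rw [adjoint_inner_right, show N w = 0 from hw, inner_zero_left]
  · refine Submodule.le_orthogonal_orthogonal _ ?_
    rw [LinearMap.mem_ker]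
    simp [apply_adjoint_apply_of_complementary hM hMN]

theorem norm_apply_of_complementary (hM : ∀ x, M.adjoint (M x) = x)
    (hMN : ∀ f, M (M.adjoint f) + N (N.adjoint f) = f) (k : K) :
    ‖N k‖ = ‖N.kerᗮ.starProjection k‖ := by
  rw [starProjection_ker_orthogonal_of_complementary hM hMN, @norm_eq_sqrt_re_inner ℂ,
    @norm_eq_sqrt_re_inner ℂ _ _ _ _ (N.adjoint _), adjoint_inner_left,
    apply_adjoint_apply_of_complementary hM hMN]

end PartialIsometry

section Series

variable {E : Type*} [NormedAddCommGroup E]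

theorem summable_norm_of_summable_disk [NormedSpace ℂ E] {a : ℕ → E}
    (h : ∀ z : 𝔻, Summable fun n : ℕ => (z : ℂ) ^ n • a n) (z : 𝔻) :
    Summable fun n : ℕ => ‖(z : ℂ)‖ ^ n * ‖a n‖ := by
  obtain ⟨r, hr1, hr2⟩ := exists_between z.norm_lt_one
  have hr0 : 0 < r := (norm_nonneg _).trans_lt hr1
  have hw := (h (.mk r (by simpa [abs_of_pos hr0] using hr2))).tendsto_atTop_zero
  obtain ⟨C, hC⟩ := hw.norm.bddAbove_range
  have hg : Summable fun n : ℕ => C * (‖(z : ℂ)‖ / r) ^ n :=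
    (summable_geometric_of_lt_one (by positivity) ((div_lt_one hr0).mpr hr1)).mul_left C
  refine Summable.of_nonneg_of_le (fun n => by positivity) (fun n => ?_) hg
  have h1 : r ^ n * ‖a n‖ ≤ C := by
    have := hC ⟨n, rfl⟩
    simp only [norm_smul, norm_pow] at this
    simpa [abs_of_pos hr0] using this
  calc ‖(z : ℂ)‖ ^ n * ‖a n‖ = (r ^ n * ‖a n‖) * (‖(z : ℂ)‖ / r) ^ n := by
        rw [div_pow]; field_simp
    _ ≤ _ := by gcongr

theorem summable_of_le_mul_add {a c : ℕ → ℝ} (ha : ∀ n, 0 ≤ a n) (hc : Summable c)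
    (hc0 : ∀ n, 0 ≤ c n) {r : ℝ} (hr : r < 1) (h : ∀ n, a (n + 1) ≤ r * a n + c n) :
    Summable a := by
  refine summable_of_sum_range_le (c := (a 0 + ∑' n, c n) / (1 - r)) ha fun n => ?_
  rw [le_div_iff₀ (by linarith)]
  have h1 : ∑ k ∈ Finset.range n, a k + a n = ∑ k ∈ Finset.range n, a (k + 1) + a 0 := by
    rw [← Finset.sum_range_succ, Finset.sum_range_succ']
  have h2 : ∑ k ∈ Finset.range n, a (k + 1) ≤
      r * ∑ k ∈ Finset.range n, a k + ∑ k ∈ Finset.range n, c k := by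
    rw [Finset.mul_sum, ← Finset.sum_add_distrib]
    exact Finset.sum_le_sum fun k _ => h k
  have h3 := hc.sum_le_tsum (Finset.range n) fun k _ => hc0 k
  linarith [ha n]

end Series

namespace AdmissibleData

variable {𝒳 𝒰 𝒴 : Type*}
  [NormedAddCommGroup 𝒳] [InnerProductSpace ℂ 𝒳] [CompleteSpace 𝒳]
  [NormedAddCommGroup 𝒰] [InnerProductSpace ℂ 𝒰] [CompleteSpace 𝒰]
  [NormedAddCommGroup 𝒴] [InnerProductSpace ℂ 𝒴] [CompleteSpace 𝒴]
  (D : AdmissibleData 𝒳 𝒰 𝒴)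

theorem inner_sqrtP (x x' : 𝒳) : ⟪D.sqrtP x, x'⟫_ℂ = ⟪x, D.sqrtP x'⟫_ℂ := by
  have hs : D.sqrtP.adjoint = D.sqrtP := (CFC.sqrt_nonneg D.P).isSelfAdjoint
  rw [← ContinuousLinearMap.adjoint_inner_right, hs]

theorem inner_sqrtP₀ (x x' : 𝒳) : ⟪D.sqrtP₀ x, D.sqrtP₀ x'⟫_ℂ = ⟪D.FS x, D.FS x'⟫_ℂ := by
  change ⟪D.sqrtP x, D.sqrtP x'⟫_ℂ = _
  rw [inner_sqrtP, ← ContinuousLinearMap.comp_apply, D.sqrtP_comp, AIPData.P,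
    ContinuousLinearMap.comp_apply, ContinuousLinearMap.adjoint_inner_right]

theorem adjoint_sqrtP₀ (v : D.X₀) : D.sqrtP₀.adjoint v = D.sqrtP v := by
  refine ext_inner_right ℂ fun x => ?_
  rw [ContinuousLinearMap.adjoint_inner_left, inner_sqrtP]
  rfl

theorem denseRange_sqrtP₀ : DenseRange D.sqrtP₀ := by
  intro w
  rw [Metric.mem_closure_iff]
  intro ε hε
  obtain ⟨b, ⟨x, rfl⟩, hb⟩ := Metric.mem_closure_iff.mp w.2 ε hε
  exact ⟨D.sqrtP₀ x, ⟨x, rfl⟩, hb⟩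

theorem sqrtP_injOn {v w : D.X₀} (h : D.sqrtP v = D.sqrtP w) : v = w := by
  rw [← adjoint_sqrtP₀, ← adjoint_sqrtP₀] at h
  refine D.denseRange_sqrtP₀.eq_of_inner_left ℂ fun x => ?_
  rw [← ContinuousLinearMap.adjoint_inner_left, h, ContinuousLinearMap.adjoint_inner_left]

variable {Δ' Δs' : Type*} [NormedAddCommGroup Δ'] [InnerProductSpace ℂ Δ']
  [NormedAddCommGroup Δs'] [InnerProductSpace ℂ Δs']
  (i : D.Δ ≃ₗᵢ[ℂ] Δ') (is : D.Δs ≃ₗᵢ[ℂ] Δs')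

theorem U_domCol (x : 𝒳) : D.U i is (WithLp.toLp 2 (D.domCol x, 0)) =
    WithLp.toLp 2 (D.ranCol x, 0) := by
  have h := D.U_toLp_add i is (D.domCol' x) 0 0
  rw [V_domCol'] at h
  simp only [map_zero, ZeroMemClass.coe_zero, add_zero] at h
  exact h

theorem blocks_sqrtP₀ (x : 𝒳) :
    D.A i is (D.sqrtP₀ x) + D.B₁ i is (D.N x) = D.sqrtP₀ (D.T x) ∧
    D.C₁ i is (D.sqrtP₀ x) + D.D₁₁ i is (D.N x) = D.E x ∧
    D.C₂ i is (D.sqrtP₀ x) + D.D₂₁ i is (D.N x) = 0 := by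
  have h := D.U_domCol i is x
  have h' := D.U_apply i is (D.sqrtP₀ x) (D.N x) 0
  change D.U i is (WithLp.toLp 2 (WithLp.toLp 2 (D.sqrtP₀ x, D.N x), 0)) =
    WithLp.toLp 2 (WithLp.toLp 2 (D.sqrtP₀ (D.T x), D.E x), 0) at h
  rw [h] at h'
  simp only [map_zero, add_zero] at h'
  have h1 := congrArg (fun w => w.fst.fst) h'
  have h2 := congrArg (fun w => w.fst.snd) h'
  have h3 := congrArg (fun w => w.snd) h'
  exact ⟨h1.symm, h2.symm, h3.symm⟩

theorem norm_sqrtP₀_T_le (x : 𝒳) : ‖D.sqrtP₀ (D.T x)‖ ≤ ‖D.sqrtP₀ x‖ + ‖D.N x‖ := by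
  have h := congrArg (· ^ 2) (D.norm_ranCol x)
  simp only [WithLp.prod_norm_sq_eq_of_L2] at h
  change ‖D.sqrtP₀ (D.T x)‖ ^ 2 + ‖D.E x‖ ^ 2 = ‖D.sqrtP₀ x‖ ^ 2 + ‖D.N x‖ ^ 2 at h
  refine le_of_sq_le_sq ?_ (by positivity)
  nlinarith [mul_nonneg (norm_nonneg (D.sqrtP₀ x)) (norm_nonneg (D.N x)), sq_nonneg ‖D.E x‖]

theorem summable_sqrtP₀ (x : 𝒳) (z : 𝔻) :
    Summable fun n : ℕ => (z : ℂ) ^ n • D.sqrtP₀ ((D.T ^ n) x) := by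
  refine Summable.of_norm ?_
  simp only [norm_smul, norm_pow]
  refine summable_of_le_mul_add (fun n => by positivity)
    ((summable_norm_of_summable_disk (D.holomorphic_N x) z).mul_left ‖(z : ℂ)‖)
    (fun n => by positivity) z.norm_lt_one fun n => ?_
  have := D.norm_sqrtP₀_T_le ((D.T ^ n) x)
  rw [← mul_apply_eq_comp, ← pow_succ'] at this
  calc _ ≤ ‖(z : ℂ)‖ ^ (n + 1) * (‖D.sqrtP₀ ((D.T ^ n) x)‖ + ‖D.N ((D.T ^ n) x)‖) := by gcongr
    _ = _ := by ring

theorem FS_eq_Γ [CompleteSpace Δs'] (ℰ : SchurFunction Δ' Δs')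
    (h : D.IsRedhefferParameter i is ℰ) (x : 𝒳) (z : 𝔻) :
    D.FS x z = D.Γ i is ℰ z (D.sqrtP₀ x) := by
  set p : D.X₀ := ∑' n : ℕ, (z : ℂ) ^ n • D.sqrtP₀ ((D.T ^ n) x) with hp
  set u : 𝒰 := obs D.N D.T x z with hu
  set y : 𝒴 := obs D.E D.T x z with hy
  have sp := (D.summable_sqrtP₀ x z).hasSum
  have su : HasSum _ u := (D.holomorphic_N x z).hasSum
  have sy : HasSum _ y := (D.holomorphic_E x z).hasSum
  rw [← hp] at sp
  have e1 : p = D.sqrtP₀ x + (z : ℂ) • (D.A i is p + D.B₁ i is u) := by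
    have s1 := (((D.A i is).hasSum sp).add ((D.B₁ i is).hasSum su)).const_smul (z : ℂ)
    have s2 : HasSum (fun n : ℕ => (z : ℂ) ^ (n + 1) • D.sqrtP₀ ((D.T ^ (n + 1)) x))
        ((z : ℂ) • (D.A i is p + D.B₁ i is u)) := by
      refine s1.congr_fun fun n => ?_
      have := (D.blocks_sqrtP₀ i is ((D.T ^ n) x)).1
      simp only [map_smul, ← smul_add, this]
      rw [pow_succ', pow_succ', mul_apply_eq_comp, mul_smul]
    have s3 := (hasSum_nat_add_iff (f := fun n : ℕ => (z : ℂ) ^ n • D.sqrtP₀ ((D.T ^ n) x)) 1).mp s2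
    rw [Finset.sum_range_one, pow_zero, pow_zero, one_smul, one_apply_eq_self, add_comm] at s3
    exact sp.unique s3
  have e2 : D.C₁ i is p + D.D₁₁ i is u = y := by
    refine (((D.C₁ i is).hasSum sp).add ((D.D₁₁ i is).hasSum su)).unique ?_
    convert sy using 1
    ext1 n
    have := (D.blocks_sqrtP₀ i is ((D.T ^ n) x)).2.1
    simp only [map_smul, ← smul_add, this]
  have e3 : D.C₂ i is p + D.D₂₁ i is u = 0 := by
    refine (((D.C₂ i is).hasSum sp).add ((D.D₂₁ i is).hasSum su)).unique ?_
    convert hasSum_zero using 1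
    ext1 n
    have := (D.blocks_sqrtP₀ i is ((D.T ^ n) x)).2.2
    simp only [map_smul, ← smul_add, this, smul_zero]
  have r1 := D.row_identity_X i is ℰ z.norm_lt_one p
  have r2 := D.row_identity_U i is ℰ z u
  rw [D.FS_apply, AIPData.FSfun, ← hu, ← hy, ← e2, h z, ← r2]
  have e4 : D.sqrtP₀ x = p - (z : ℂ) • (D.A i is p + D.B₁ i is u) := eq_sub_of_add_eq e1.symm
  have e5 := congrArg (fun w => D.G i is ℰ z (ℰ z w)) e3
  simp only [map_add, map_zero] at e5
  rw [e4, map_sub, map_smul, map_add, ← r1]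
  rw [add_eq_zero_iff_eq_neg] at e5
  rw [e5, smul_add]
  abel

variable [CompleteSpace Δ'] [CompleteSpace Δs'] (ℰ : SchurFunction Δ' Δs')

theorem exists_complementary (h : D.IsRedhefferParameter i is ℰ) :
    ∃ (M : D.X₀ →L[ℂ] H D.S) (N : H ℰ →L[ℂ] H D.S),
      (∀ (x : D.X₀) (z : 𝔻), M x z = D.Γ i is ℰ z x) ∧
      (∀ (k : H ℰ) (z : 𝔻), N k z = D.G i is ℰ z (k z)) ∧
      (∀ x, M (D.sqrtP₀ x) = D.FS x) ∧
      (∀ x, M.adjoint (M x) = x) ∧ ∀ f, M (M.adjoint f) + N (N.adjoint f) = f := by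
  obtain ⟨J, hJ, -, hJn⟩ := exists_contraction_of_inner_eq
    (fun p : 𝔻 × 𝒴 => RKHS.kerFun (H D.S) p.1 p.2)
    (fun p : 𝔻 × 𝒴 => (WithLp.toLp 2 ((D.Γ i is ℰ p.1).adjoint p.2,
      RKHS.kerFun (H ℰ) p.1 ((D.G i is ℰ p.1).adjoint p.2)) : WithLp 2 (D.X₀ × H ℰ)))
    (fun p q => by
      rw [WithLp.prod_inner_apply]
      exact D.inner_kerFun_eq i is ℰ h p.1 q.1 p.2 q.2)
  have hJn : ∀ f, ‖J f‖ = ‖f‖ := fun f => hJn f <| by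
    have : Set.range (fun p : 𝔻 × 𝒴 => RKHS.kerFun (H D.S) p.1 p.2) =
        {RKHS.kerFun (H D.S) x v | (x) (v)} := by
      ext; simp
    rw [this, RKHS.kerFun_dense]
    trivial
  let e := (WithLp.prodContinuousLinearEquiv 2 ℂ D.X₀ (H ℰ)).symm.toContinuousLinearMap
  let M : D.X₀ →L[ℂ] H D.S := J.adjoint ∘L e ∘L ContinuousLinearMap.inl ℂ D.X₀ (H ℰ)
  let N : H ℰ →L[ℂ] H D.S := J.adjoint ∘L e ∘L ContinuousLinearMap.inr ℂ D.X₀ (H ℰ)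
  have hM : ∀ (x : D.X₀) (z : 𝔻), M x z = D.Γ i is ℰ z x := fun x z => by
    refine ext_inner_left ℂ fun v => ?_
    rw [← RKHS.kerFun_inner]
    change ⟪_, J.adjoint (WithLp.toLp 2 (x, 0))⟫_ℂ = _
    rw [ContinuousLinearMap.adjoint_inner_right, hJ (z, v), WithLp.prod_inner_apply]
    simp [ContinuousLinearMap.adjoint_inner_left]
  have hN : ∀ (k : H ℰ) (z : 𝔻), N k z = D.G i is ℰ z (k z) := fun k z => by
    refine ext_inner_left ℂ fun v => ?_
    rw [← RKHS.kerFun_inner]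
    change ⟪_, J.adjoint (WithLp.toLp 2 (0, k))⟫_ℂ = _
    rw [ContinuousLinearMap.adjoint_inner_right, hJ (z, v), WithLp.prod_inner_apply]
    simp [ContinuousLinearMap.adjoint_inner_left]
  have hF : ∀ x, M (D.sqrtP₀ x) = D.FS x := fun x => RKHS.ext fun z => by
    rw [hM, D.FS_eq_Γ i is ℰ h]
  refine ⟨M, N, hM, hN, hF, ?_, fun f => ?_⟩
  · have hn : ∀ x, ‖M x‖ = ‖x‖ := fun x => by
      refine D.denseRange_sqrtP₀.induction_on (p := fun x => ‖M x‖ = ‖x‖) x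
        (isClosed_eq (by fun_prop) (by fun_prop)) fun x => ?_
      rw [hF, ← D.norm_sqrtP]
      rfl
    exact fun x => DFunLike.congr_fun
      ((ContinuousLinearMap.norm_map_iff_adjoint_comp_self _).mp hn) x
  · have hMa : ∀ f, M.adjoint f = (J f).fst := fun f => ext_inner_right ℂ fun x => by
      rw [ContinuousLinearMap.adjoint_inner_left]
      change ⟪f, J.adjoint (WithLp.toLp 2 (x, 0))⟫_ℂ = _
      rw [ContinuousLinearMap.adjoint_inner_right, WithLp.prod_inner_apply]
      simp
    have hNa : ∀ f, N.adjoint f = (J f).snd := fun f => ext_inner_right ℂ fun x => by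
      rw [ContinuousLinearMap.adjoint_inner_left]
      change ⟪f, J.adjoint (WithLp.toLp 2 (0, x))⟫_ℂ = _
      rw [ContinuousLinearMap.adjoint_inner_right, WithLp.prod_inner_apply]
      simp
    have hJJ := DFunLike.congr_fun
      ((ContinuousLinearMap.norm_map_iff_adjoint_comp_self _).mp hJn) f
    change J.adjoint (WithLp.toLp 2 (M.adjoint f, 0)) +
      J.adjoint (WithLp.toLp 2 (0, N.adjoint f)) = f
    rw [← map_add, ← WithLp.toLp_add, hMa, hNa]
    rw [Prod.mk_add_mk, add_zero, zero_add]
    exact hJJ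

end AdmissibleData

section Realization

variable {E F : Type*}
  [NormedAddCommGroup E] [InnerProductSpace ℂ E] [CompleteSpace E]
  [NormedAddCommGroup F] [InnerProductSpace ℂ F] [CompleteSpace F]

theorem continuous_of_continuous_gram {X L : Type*} [TopologicalSpace X] [NormedAddCommGroup L]
    [InnerProductSpace ℂ L] {k : X → L} (h : Continuous fun p : X × X => ⟪k p.1, k p.2⟫_ℂ) :
    Continuous k := by
  rw [continuous_iff_continuousAt]
  intro x
  rw [ContinuousAt, tendsto_iff_norm_sub_tendsto_zero]
  have h1 : Continuous fun y => (⟪k y, k y⟫_ℂ - ⟪k y, k x⟫_ℂ - (⟪k x, k y⟫_ℂ - ⟪k x, k x⟫_ℂ)).re :=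
    Complex.continuous_re.comp (((h.comp (.prodMk continuous_id continuous_id)).sub
      (h.comp (.prodMk continuous_id continuous_const))).sub
      ((h.comp (.prodMk continuous_const continuous_id)).sub continuous_const))
  have h2 := (Real.continuous_sqrt.comp h1).tendsto x
  simp only [Function.comp_apply, sub_self, Complex.zero_re, Real.sqrt_zero] at h2
  refine h2.congr fun y => ?_
  rw [@norm_eq_sqrt_re_inner ℂ, inner_sub_left, inner_sub_right, inner_sub_right]
  rfl

variable (S : SchurFunction E F)

theorem continuous_kerFun (v : F) : Continuous fun z : 𝔻 => RKHS.kerFun (H S) z v := by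
  have hS : Continuous fun z : 𝔻 => (S z).adjoint v := by
    have h1 : Continuous fun z : 𝔻 => S z :=
      S.differentiableOn.continuousOn.comp_continuous Complex.UnitDisc.continuous_coe
        fun z => by simpa using z.norm_lt_one
    exact ((ContinuousLinearMap.adjoint (𝕜 := ℂ) (E := E) (F := F)).continuous.comp h1).clm_apply
      continuous_const
  have hc : Continuous fun z : 𝔻 => (z : ℂ) := Complex.UnitDisc.continuous_coe
  refine continuous_of_continuous_gram ?_
  have h : ∀ p : 𝔻 × 𝔻, ⟪RKHS.kerFun (H S) p.1 v, RKHS.kerFun (H S) p.2 v⟫_ℂ =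
      (1 - (p.1 : ℂ) * conj (p.2 : ℂ))⁻¹ * (⟪v, v⟫_ℂ - ⟪(S p.1).adjoint v, (S p.2).adjoint v⟫_ℂ) :=
    fun p => by
      rw [← inner_kerFun_H, inv_mul_cancel_left₀ (one_sub_mul_conj_ne_zero p.1 p.2)]
  simp only [h]
  refine Continuous.mul (Continuous.inv₀ ?_ fun p => one_sub_mul_conj_ne_zero p.1 p.2) ?_
  · exact continuous_const.sub ((hc.comp continuous_fst).mul
      (Complex.continuous_conj.comp (hc.comp continuous_snd)))
  · exact continuous_const.sub ((hS.comp continuous_fst).inner (hS.comp continuous_snd))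

theorem H_ext_of_ne_zero {f g : H S} (h : ∀ z : 𝔻, (z : ℂ) ≠ 0 → f z = g z) : f = g := by
  refine RKHS.ext fun z => ?_
  by_cases hz : (z : ℂ) = 0
  swap
  · exact h z hz
  have hz : z = 0 := Complex.UnitDisc.coe_injective (by simpa using hz)
  subst hz
  refine ext_inner_left ℂ fun v => ?_
  let ζ : ℕ → 𝔻 := fun n => .mk ((1 / ((n : ℝ) + 2) : ℝ) : ℂ) (by
    rw [Complex.norm_real, Real.norm_eq_abs, abs_of_pos (by positivity), div_lt_one (by positivity)]
    have : (0 : ℝ) ≤ n := n.cast_nonneg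
    linarith)
  have hζ : Filter.Tendsto ζ Filter.atTop (nhds 0) := by
    rw [Complex.UnitDisc.isEmbedding_coe.tendsto_nhds_iff]
    have h1 : Filter.Tendsto (fun n : ℕ => 1 / ((n : ℝ) + 2)) Filter.atTop (nhds 0) := by
      refine tendsto_const_nhds.div_atTop ?_
      exact Filter.tendsto_atTop_add_const_right _ _ tendsto_natCast_atTop_atTop
    have h2 := (Complex.continuous_ofReal.tendsto 0).comp h1
    rw [Complex.UnitDisc.coe_zero, ← Complex.ofReal_zero]
    exact h2
  have hc : ∀ f : H S, Filter.Tendsto (fun n => ⟪v, f (ζ n)⟫_ℂ) Filter.atTop (nhds ⟪v, f 0⟫_ℂ) := by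
    intro f
    simp only [← RKHS.kerFun_inner]
    exact ((((continuous_kerFun S v).tendsto 0).comp hζ)).inner tendsto_const_nhds
  refine tendsto_nhds_unique (hc f) ((hc g).congr fun n => ?_)
  rw [h]
  have : (0 : ℝ) < 1 / ((n : ℝ) + 2) := by positivity
  exact Complex.ofReal_ne_zero.mpr this.ne'

/-- A contractive colligation with state space `H(S)` realizing `S` (the functional-model
realization): `R (f, u) = (g, y)` satisfies `ζ g(ζ) + y = f(ζ) + S(ζ) u`. -/
theorem exists_realization : ∃ R : WithLp 2 (H S × E) →L[ℂ] WithLp 2 (H S × F),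
    (∀ w, ‖R w‖ ≤ ‖w‖) ∧
    ∀ w (ζ : 𝔻), (ζ : ℂ) • (R w).fst ζ + (R w).snd = w.fst ζ + S ζ w.snd := by
  obtain ⟨T, hT, hTn, -⟩ := exists_contraction_of_inner_eq
    (fun p : 𝔻 × F => (WithLp.toLp 2 (conj (p.1 : ℂ) • RKHS.kerFun (H S) p.1 p.2, p.2) :
      WithLp 2 (H S × F)))
    (fun p : 𝔻 × F => (WithLp.toLp 2 (RKHS.kerFun (H S) p.1 p.2, (S p.1).adjoint p.2) :
      WithLp 2 (H S × E)))
    (fun p q => by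
      have := inner_kerFun_H S p.1 q.1 p.2 q.2
      simp only [WithLp.prod_inner_apply, inner_smul_left, inner_smul_right, Complex.conj_conj]
      linear_combination -this)
  refine ⟨T.adjoint, fun w => ?_, fun w ζ => ext_inner_left ℂ fun v => ?_⟩
  · have h1 : ‖T‖ ≤ 1 := T.opNorm_le_bound zero_le_one (by simpa using hTn)
    have h2 : ‖T.adjoint‖ ≤ 1 := by rwa [LinearIsometryEquiv.norm_map]
    simpa using T.adjoint.le_of_opNorm_le h2 w
  · have h := ContinuousLinearMap.adjoint_inner_right T
      (WithLp.toLp 2 (conj (ζ : ℂ) • RKHS.kerFun (H S) ζ v, v)) w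
    rw [hT (ζ, v), WithLp.prod_inner_apply, WithLp.prod_inner_apply] at h
    simp only [inner_smul_left, Complex.conj_conj, RKHS.kerFun_inner,
      ContinuousLinearMap.adjoint_inner_left] at h
    rw [inner_add_right, inner_add_right, inner_smul_right]
    exact h

end Realization

theorem adjoint_apply_of_contraction {E F : Type*}
    [NormedAddCommGroup E] [InnerProductSpace ℂ E] [CompleteSpace E]
    [NormedAddCommGroup F] [InnerProductSpace ℂ F] [CompleteSpace F]
    {R : E →L[ℂ] F} (hR : ∀ x, ‖R x‖ ≤ ‖x‖) {a : E} (ha : ‖R a‖ = ‖a‖) : R.adjoint (R a) = a := by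
  have h1 : ‖R‖ ≤ 1 := R.opNorm_le_bound zero_le_one (by simpa using hR)
  have h2 : ‖R.adjoint‖ ≤ 1 := by rwa [LinearIsometryEquiv.norm_map]
  have h3 : ‖R.adjoint (R a)‖ ≤ ‖a‖ := by
    rw [← ha]; simpa using R.adjoint.le_of_opNorm_le h2 (R a)
  have h4 : RCLike.re ⟪R.adjoint (R a), a⟫_ℂ = ‖a‖ ^ 2 := by
    rw [ContinuousLinearMap.adjoint_inner_left, inner_self_eq_norm_sq, ha]
  have h5 := @norm_sub_sq ℂ _ _ _ _ (R.adjoint (R a)) a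
  rw [h4] at h5
  have h6 : ‖R.adjoint (R a) - a‖ ^ 2 ≤ 0 := by
    nlinarith [norm_nonneg (R.adjoint (R a))]
  exact sub_eq_zero.mp (norm_eq_zero.mp (pow_eq_zero_iff two_ne_zero |>.mp
    (le_antisymm h6 (sq_nonneg _))))

section Obs

variable {X W : Type*} [NormedAddCommGroup X] [InnerProductSpace ℂ X] [CompleteSpace X]
  [NormedAddCommGroup W] [InnerProductSpace ℂ W]

omit [CompleteSpace X] in
theorem obs_eq_add {C : X →L[ℂ] W} {T : X →L[ℂ] X} {x : X} {z : ℂ}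
    (h : Summable fun n : ℕ => z ^ n • C ((T ^ n) x))
    (hT : Summable fun n : ℕ => z ^ n • C ((T ^ n) (T x))) :
    obs C T x z = C x + z • obs C T (T x) z := by
  have h1 := hT.hasSum.const_smul z
  have h2 : HasSum (fun n : ℕ => z ^ (n + 1) • C ((T ^ (n + 1)) x)) (z • obs C T (T x) z) := by
    refine h1.congr_fun fun n => ?_
    rw [pow_succ', pow_succ, mul_apply_eq_comp, mul_smul]
  have h3 := (hasSum_nat_add_iff (f := fun n : ℕ => z ^ n • C ((T ^ n) x)) 1).mp h2
  rw [Finset.sum_range_one, pow_zero, pow_zero, one_smul, one_apply_eq_self, add_comm] at h3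
  exact h.hasSum.unique h3

end Obs

namespace AdmissibleData

variable {𝒳 𝒰 𝒴 : Type*}
  [NormedAddCommGroup 𝒳] [InnerProductSpace ℂ 𝒳] [CompleteSpace 𝒳]
  [NormedAddCommGroup 𝒰] [InnerProductSpace ℂ 𝒰] [CompleteSpace 𝒰]
  [NormedAddCommGroup 𝒴] [InnerProductSpace ℂ 𝒴] [CompleteSpace 𝒴]
  (D : AdmissibleData 𝒳 𝒰 𝒴)

theorem FS_add (x : 𝒳) (z : 𝔻) :
    D.FS x z + D.S z (D.N x) = D.E x + (z : ℂ) • D.FS (D.T x) z := by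
  rw [D.FS_apply, D.FS_apply, AIPData.FSfun, AIPData.FSfun,
    obs_eq_add (D.holomorphic_E x z) (D.holomorphic_E _ z),
    obs_eq_add (D.holomorphic_N x z) (D.holomorphic_N _ z), map_add, map_smul, smul_sub]
  abel

theorem realization_FS {R : WithLp 2 (H D.S × 𝒰) →L[ℂ] WithLp 2 (H D.S × 𝒴)}
    (hR : ∀ w (ζ : 𝔻), (ζ : ℂ) • (R w).fst ζ + (R w).snd = w.fst ζ + D.S ζ w.snd) (x : 𝒳) :
    R (WithLp.toLp 2 (D.FS x, D.N x)) = WithLp.toLp 2 (D.FS (D.T x), D.E x) := by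
  have h := hR (WithLp.toLp 2 (D.FS x, D.N x))
  have h' : ∀ ζ : 𝔻, (ζ : ℂ) • (R (WithLp.toLp 2 (D.FS x, D.N x))).fst ζ +
      (R (WithLp.toLp 2 (D.FS x, D.N x))).snd = D.E x + (ζ : ℂ) • D.FS (D.T x) ζ :=
    fun ζ => (h ζ).trans (D.FS_add x ζ)
  have h0 : (R (WithLp.toLp 2 (D.FS x, D.N x))).snd = D.E x := by simpa using h' 0
  have h1 : (R (WithLp.toLp 2 (D.FS x, D.N x))).fst = D.FS (D.T x) := by
    refine H_ext_of_ne_zero D.S fun ζ hζ => ?_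
    have h2 := h' ζ
    rw [h0, add_comm, add_right_inj] at h2
    exact smul_right_injective _ hζ h2
  rw [← h0, ← h1]
  rfl

theorem exists_embedding : ∃ j : D.X₀ →L[ℂ] H D.S, (∀ x, j (D.sqrtP₀ x) = D.FS x) ∧
    ∀ x, j.adjoint (j x) = x := by
  obtain ⟨j, hj, -, hjn⟩ := exists_contraction_of_inner_eq (fun x => D.sqrtP₀ x)
    (fun x => D.FS x) D.inner_sqrtP₀
  refine ⟨j, hj, fun x => DFunLike.congr_fun
    ((ContinuousLinearMap.norm_map_iff_adjoint_comp_self j).mp fun x => hjn x ?_) x⟩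
  exact closure_mono Submodule.subset_span (D.denseRange_sqrtP₀ x)

/-- The residual part of a contractive extension of `V` is a contraction from
`Δ ⊕ (state space)` to `Δ_* ⊕ (state space)`, and the extension is recovered by feedback. -/
theorem exists_residual {L : Type*} [NormedAddCommGroup L] [InnerProductSpace ℂ L] [CompleteSpace L]
    {j : D.X₀ →L[ℂ] L} (hj : ∀ x, j.adjoint (j x) = x)
    {R : WithLp 2 (L × 𝒰) →L[ℂ] WithLp 2 (L × 𝒴)} (hR : ∀ w, ‖R w‖ ≤ ‖w‖)
    (hV : ∀ x, R (WithLp.toLp 2 (j (D.sqrtP₀ x), D.N x)) =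
      WithLp.toLp 2 (j (D.sqrtP₀ (D.T x)), D.E x)) :
    ∃ (A : L →L[ℂ] L) (B : D.Δ →L[ℂ] L) (C : L →L[ℂ] D.Δs) (D' : D.Δ →L[ℂ] D.Δs),
      (∀ x u, ‖A x + B u‖ ^ 2 + ‖C x + D' u‖ ^ 2 ≤ ‖x‖ ^ 2 + ‖u‖ ^ 2) ∧
      ∀ (z : ℂ) (h : L) (u : 𝒰) (y : 𝒴), R (WithLp.toLp 2 (z • h, u)) = WithLp.toLp 2 (h, y) →
        ∃ (p : D.domV) (q : D.Δ) (k : L),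
          WithLp.toLp 2 (z • j.adjoint h, u) = (p + q : WithLp 2 (D.X₀ × 𝒰)) ∧
          WithLp.toLp 2 (j.adjoint h, y) =
            (D.V p + (C (z • k) + D' q : D.Δs) : WithLp 2 (D.X₀ × 𝒴)) ∧
          A (z • k) + B q = k := by
  let Q : L →L[ℂ] L := 1 - j ∘L j.adjoint
  have hQ : ∀ h, Q h = h - j (j.adjoint h) := fun h => rfl
  have hjQ : ∀ h, j.adjoint (Q h) = 0 := fun h => by rw [hQ, map_sub, hj, sub_self]
  have hQj : ∀ x, Q (j x) = 0 := fun x => by rw [hQ, hj, sub_self]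
  have hQQ : ∀ h, Q (Q h) = Q h := fun h => by rw [hQ, hjQ, map_zero, sub_zero]
  have hjn : ∀ x, ‖j x‖ = ‖x‖ := fun x => by
    rw [@norm_eq_sqrt_re_inner ℂ, ← ContinuousLinearMap.adjoint_inner_left, hj,
      ← @norm_eq_sqrt_re_inner ℂ]
  have horth : ∀ x h, ⟪j x, Q h⟫_ℂ = 0 := fun x h => by
    rw [← ContinuousLinearMap.adjoint_inner_right, hjQ, inner_zero_right]
  have hpyth : ∀ x h, ‖Q h + j x‖ ^ 2 = ‖Q h‖ ^ 2 + ‖x‖ ^ 2 := fun x h => by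
    have := norm_add_sq_eq_norm_sq_add_norm_sq_of_inner_eq_zero _ _ (horth x h)
    rw [hjn] at this
    rw [add_comm]
    linarith
  have hpyth' : ∀ h, ‖h‖ ^ 2 = ‖Q h‖ ^ 2 + ‖j.adjoint h‖ ^ 2 := fun h => by
    rw [← hpyth, hQ, sub_add_cancel]
  let J₁ : WithLp 2 (D.X₀ × 𝒰) →L[ℂ] WithLp 2 (L × 𝒰) :=
    (WithLp.prodContinuousLinearEquiv 2 ℂ L 𝒰).symm.toContinuousLinearMap ∘L
      (j ∘L WithLp.fstL 2 ℂ D.X₀ 𝒰).prod (WithLp.sndL 2 ℂ D.X₀ 𝒰)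
  have hJ₁ : ∀ w, J₁ w = WithLp.toLp 2 (j w.fst, w.snd) := fun w => rfl
  let J₂ : WithLp 2 (D.X₀ × 𝒴) →L[ℂ] WithLp 2 (L × 𝒴) :=
    (WithLp.prodContinuousLinearEquiv 2 ℂ L 𝒴).symm.toContinuousLinearMap ∘L
      (j ∘L WithLp.fstL 2 ℂ D.X₀ 𝒴).prod (WithLp.sndL 2 ℂ D.X₀ 𝒴)
  have hJ₂ : ∀ w, J₂ w = WithLp.toLp 2 (j w.fst, w.snd) := fun w => rfl
  let J₂' : WithLp 2 (L × 𝒴) →L[ℂ] WithLp 2 (D.X₀ × 𝒴) :=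
    (WithLp.prodContinuousLinearEquiv 2 ℂ D.X₀ 𝒴).symm.toContinuousLinearMap ∘L
      (j.adjoint ∘L WithLp.fstL 2 ℂ L 𝒴).prod (WithLp.sndL 2 ℂ L 𝒴)
  have hJ₂' : ∀ w, J₂' w = WithLp.toLp 2 (j.adjoint w.fst, w.snd) := fun w => rfl
  have hJ₂J₂' : ∀ w, J₂' (J₂ w) = w := fun w => by
    rw [hJ₂, hJ₂']
    change WithLp.toLp 2 (j.adjoint (j w.fst), w.snd) = w
    rw [hj]
    rfl
  have hJ₂adj : ∀ w r, ⟪J₂ w, r⟫_ℂ = ⟪w, J₂' r⟫_ℂ := fun w r => by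
    rw [hJ₂, hJ₂', WithLp.prod_inner_apply, WithLp.prod_inner_apply]
    change ⟪j w.fst, r.fst⟫_ℂ + ⟪w.snd, r.snd⟫_ℂ =
      ⟪w.fst, j.adjoint r.fst⟫_ℂ + ⟪w.snd, r.snd⟫_ℂ
    rw [ContinuousLinearMap.adjoint_inner_right]
  let κ : L →L[ℂ] WithLp 2 (L × 𝒰) :=
    (WithLp.prodContinuousLinearEquiv 2 ℂ L 𝒰).symm.toContinuousLinearMap ∘L
      ContinuousLinearMap.inl ℂ L 𝒰
  have hκ : ∀ h, κ h = WithLp.toLp 2 (h, 0) := fun h => rfl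
  have hin : ∀ h w, ‖κ (Q h) + J₁ w‖ ^ 2 = ‖Q h‖ ^ 2 + ‖w‖ ^ 2 := fun h w => by
    rw [hκ, hJ₁, WithLp.prod_norm_sq_eq_of_L2, WithLp.prod_norm_sq_eq_of_L2]
    change ‖Q h + j w.fst‖ ^ 2 + ‖0 + w.snd‖ ^ 2 = _
    rw [hpyth, zero_add, add_assoc]
  have hout : ∀ r, ‖r‖ ^ 2 = ‖Q r.fst‖ ^ 2 + ‖J₂' r‖ ^ 2 := fun r => by
    rw [hJ₂', WithLp.prod_norm_sq_eq_of_L2, WithLp.prod_norm_sq_eq_of_L2, hpyth' r.fst]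
    exact add_assoc _ _ _
  let π := D.Δs.orthogonalProjectionOnto
  refine ⟨Q ∘L WithLp.fstL 2 ℂ L 𝒴 ∘L R ∘L κ ∘L Q,
    Q ∘L WithLp.fstL 2 ℂ L 𝒴 ∘L R ∘L J₁ ∘L D.Δ.subtypeL,
    π ∘L J₂' ∘L R ∘L κ ∘L Q, π ∘L J₂' ∘L R ∘L J₁ ∘L D.Δ.subtypeL, fun h q => ?_,
    fun z h u y hhy => ?_⟩
  · simp only [ContinuousLinearMap.comp_apply, ← map_add]
    set w := κ (Q h) + J₁ (D.Δ.subtypeL q)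
    have h1 : ‖w‖ ^ 2 = ‖Q h‖ ^ 2 + ‖q‖ ^ 2 := hin h q
    have h2 : ‖Q h‖ ^ 2 ≤ ‖h‖ ^ 2 := by rw [hpyth' h]; linarith [sq_nonneg ‖j.adjoint h‖]
    have h3 := hout (R w)
    have h4 : ‖π (J₂' (R w))‖ ^ 2 ≤ ‖J₂' (R w)‖ ^ 2 := by
      gcongr; exact Submodule.norm_orthogonalProjectionOnto_apply_le _ _
    have h5 : ‖R w‖ ^ 2 ≤ ‖w‖ ^ 2 := by gcongr; exact hR w
    change ‖Q (R w).fst‖ ^ 2 + _ ≤ _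
    linarith
  · obtain ⟨p, q, hpq⟩ := D.exists_eq_add (WithLp.toLp 2 (z • j.adjoint h, u))
    have hRV : ∀ p : D.domV, R (J₁ p) = J₂ (D.V p) := fun p => by
      refine D.denseRange_domCol'.induction_on (p := fun p : D.domV => R (J₁ p) = J₂ (D.V p)) p
        (isClosed_eq (by fun_prop) (by fun_prop)) fun x => ?_
      rw [V_domCol']
      exact hV x
    have hJ₁n : ∀ w, ‖J₁ w‖ ^ 2 = ‖w‖ ^ 2 := fun w => by
      have := hin 0 w
      simpa using this
    have hJ₂n : ∀ w, ‖J₂ w‖ ^ 2 = ‖w‖ ^ 2 := fun w => by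
      have := hout (J₂ w)
      rw [hJ₂J₂'] at this
      rw [this, hJ₂]
      change ‖Q (j w.fst)‖ ^ 2 + _ = _
      rw [hQj]
      simp
    have hRR : ∀ p : D.domV, R.adjoint (R (J₁ p)) = J₁ p := fun p => by
      refine adjoint_apply_of_contraction hR ?_
      rw [← sq_eq_sq₀ (norm_nonneg _) (norm_nonneg _), hRV, hJ₂n, hJ₁n, D.norm_V]
      rfl
    set s := κ (Q (z • Q h)) + J₁ q with hs
    have hsum : WithLp.toLp 2 (z • h, u) = J₁ p + s := by
      have h1 : J₁ (WithLp.toLp 2 (z • j.adjoint h, u)) = J₁ p + J₁ q := by rw [hpq, map_add]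
      rw [hs, add_left_comm, ← h1, hJ₁, hκ, ← WithLp.toLp_add, Prod.mk_add_mk]
      change _ = WithLp.toLp 2 (Q (z • Q h) + j (z • j.adjoint h), 0 + u)
      rw [map_smul, hQQ, map_smul, ← smul_add, hQ, sub_add_cancel, zero_add]
    have hRs : WithLp.toLp 2 (h, y) = J₂ (D.V p) + R s := by
      rw [← hhy, hsum, map_add, hRV]
    have hmem : J₂' (R s) ∈ D.Δs := by
      intro r hr
      obtain ⟨p', rfl⟩ := D.exists_V_eq hr
      rw [← hJ₂adj, ← hRV, ← ContinuousLinearMap.adjoint_inner_left, hRR, hs, inner_add_right]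
      have h1 : ⟪J₁ p', κ (Q (z • Q h))⟫_ℂ = 0 := by
        rw [hJ₁, hκ, WithLp.prod_inner_apply]
        change ⟪j _, Q _⟫_ℂ + ⟪_, (0 : 𝒰)⟫_ℂ = 0
        rw [horth, inner_zero_right, add_zero]
      have h2 : ⟪J₁ p', J₁ q⟫_ℂ = ⟪(p' : WithLp 2 (D.X₀ × 𝒰)), q⟫_ℂ := by
        rw [hJ₁, hJ₁, WithLp.prod_inner_apply, WithLp.prod_inner_apply]
        change ⟪j _, j _⟫_ℂ + _ = _
        rw [← ContinuousLinearMap.adjoint_inner_left, hj]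
        rfl
      rw [h1, h2, zero_add]
      exact q.2 _ p'.2
    refine ⟨p, q, Q h, hpq, ?_, ?_⟩
    · simp only [ContinuousLinearMap.comp_apply, ← map_add]
      change _ = D.V p + ((π (J₂' (R s)) : D.Δs) : WithLp 2 (D.X₀ × 𝒴))
      rw [show ((π (J₂' (R s)) : D.Δs) : WithLp 2 (D.X₀ × 𝒴)) = J₂' (R s) from
        Submodule.starProjection_eq_self_iff.mpr hmem]
      have := congrArg J₂' hRs
      rwa [map_add, hJ₂J₂'] at this
    · simp only [ContinuousLinearMap.comp_apply, ← map_add]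
      change Q (R s).fst = Q h
      have h1 : h = (J₂ (D.V p)).fst + (R s).fst := congrArg (fun w => w.fst) hRs
      conv_rhs => rw [h1, map_add]
      change _ = Q (j _) + _
      rw [hQj, zero_add]

variable {Δ' Δs' : Type*} [NormedAddCommGroup Δ'] [InnerProductSpace ℂ Δ']
  [NormedAddCommGroup Δs'] [InnerProductSpace ℂ Δs'] [CompleteSpace Δs']
  (i : D.Δ ≃ₗᵢ[ℂ] Δ') (is : D.Δs ≃ₗᵢ[ℂ] Δs')

theorem redheffer_apply_of_feedback (ℰ : SchurFunction Δ' Δs') {z : ℂ} (hz : ‖z‖ < 1) {x : D.X₀}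
    {u : 𝒰} {y : 𝒴} {e : Δ'}
    (h : D.U i is (WithLp.toLp 2 (WithLp.toLp 2 (z • x, u), ℰ z e)) =
      WithLp.toLp 2 (WithLp.toLp 2 (x, y), e)) : D.redheffer i is ℰ z u = y := by
  rw [D.U_apply] at h
  have h1 : D.A i is (z • x) + D.B₁ i is u + D.B₂ i is (ℰ z e) = x :=
    congrArg (fun w => w.fst.fst) h
  have h2 : D.C₁ i is (z • x) + D.D₁₁ i is u + D.D₁₂ i is (ℰ z e) = y :=
    congrArg (fun w => w.fst.snd) h
  have h3 : D.C₂ i is (z • x) + D.D₂₁ i is u + D.D₂₂ i is (ℰ z e) = e :=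
    congrArg (fun w => w.snd) h
  replace h1 := congrArg (fun w => z • D.Γ i is ℰ z w) h1
  replace h3 := congrArg (fun w => D.G i is ℰ z (ℰ z w)) h3
  simp only [map_add, smul_add] at h1 h3
  have r1 := D.row_identity_X i is ℰ hz (z • x)
  have r2 := D.row_identity_U i is ℰ z u
  have r3 := D.row_identity_Δ i is ℰ hz (ℰ z e)
  rw [map_smul (D.Γ i is ℰ z)] at r1
  have h4 := congrArg₂ (· + ·) (congrArg₂ (· + ·) r1 r2) r3
  have h5 := congrArg₂ (· + ·) (congrArg₂ (· + ·) h1 h2) h3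
  exact add_left_cancel (add_right_cancel (h4.symm.trans (Eq.trans (by abel) h5)))

theorem exists_redhefferParameter : ∃ ℰ : SchurFunction Δ' Δs', D.IsRedhefferParameter i is ℰ := by
  obtain ⟨j, hjF, hj⟩ := D.exists_embedding
  obtain ⟨R, hR, hRS⟩ := exists_realization D.S
  obtain ⟨A, B, C, D', hM, hfb⟩ := D.exists_residual hj hR fun x => by
    rw [hjF, hjF, D.realization_FS hRS]
  let ℰ : SchurFunction Δ' Δs' := transferSchur A (B ∘L (i.symm : Δ' →L[ℂ] D.Δ))
    ((is : D.Δs →L[ℂ] Δs') ∘L C) ((is : D.Δs →L[ℂ] Δs') ∘L D' ∘L (i.symm : Δ' →L[ℂ] D.Δ))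
    fun x u => by
      have := hM x (i.symm u)
      rw [i.symm.norm_map, ← is.norm_map, map_add] at this
      exact this
  refine ⟨ℰ, fun z => ContinuousLinearMap.ext fun u => ?_⟩
  let A₀ : H D.S →L[ℂ] H D.S := WithLp.fstL 2 ℂ (H D.S) 𝒴 ∘L R ∘L
    (WithLp.prodContinuousLinearEquiv 2 ℂ (H D.S) 𝒰).symm.toContinuousLinearMap ∘L
      ContinuousLinearMap.inl ℂ (H D.S) 𝒰
  let B₀ : 𝒰 →L[ℂ] H D.S := WithLp.fstL 2 ℂ (H D.S) 𝒴 ∘L R ∘L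
    (WithLp.prodContinuousLinearEquiv 2 ℂ (H D.S) 𝒰).symm.toContinuousLinearMap ∘L
      ContinuousLinearMap.inr ℂ (H D.S) 𝒰
  have hA₀ : ∀ x, ‖A₀ x‖ ≤ ‖x‖ := fun x => by
    have h1 := hR (WithLp.toLp 2 (x, 0))
    have h2 := WithLp.prod_norm_sq_eq_of_L2 (R (WithLp.toLp 2 (x, 0)))
    have h3 := WithLp.prod_norm_sq_eq_of_L2 (WithLp.toLp 2 (x, (0 : 𝒰)))
    change _ = ‖x‖ ^ 2 + ‖(0 : 𝒰)‖ ^ 2 at h3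
    rw [norm_zero] at h3
    change ‖(R (WithLp.toLp 2 (x, 0))).fst‖ ≤ _
    refine le_of_sq_le_sq ?_ (norm_nonneg _)
    have h4 := pow_le_pow_left₀ (norm_nonneg _) h1 2
    linarith [sq_nonneg ‖(R (WithLp.toLp 2 (x, 0))).snd‖]
  obtain ⟨h, hh⟩ := exists_state (B := B₀) hA₀ z.norm_lt_one u
  have hfst : (R (WithLp.toLp 2 ((z : ℂ) • h, u))).fst = h := by
    have : (WithLp.toLp 2 ((z : ℂ) • h, u) : WithLp 2 (H D.S × 𝒰)) =
        WithLp.toLp 2 ((z : ℂ) • h, 0) + WithLp.toLp 2 (0, u) := by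
      rw [← WithLp.toLp_add, Prod.mk_add_mk, add_zero, zero_add]
    rw [this, map_add]
    exact hh
  have hsnd : (R (WithLp.toLp 2 ((z : ℂ) • h, u))).snd = D.S z u := by
    have h1 := hRS (WithLp.toLp 2 ((z : ℂ) • h, u)) z
    change _ = ((z : ℂ) • h) z + D.S z u at h1
    rw [hfst, RKHS.coe_smul] at h1
    exact add_left_cancel h1
  have hRh : R (WithLp.toLp 2 ((z : ℂ) • h, u)) = WithLp.toLp 2 (h, D.S z u) :=
    WithLp.ofLp_injective 2 (Prod.ext hfst hsnd)
  obtain ⟨p, q, k, h1, h2, h3⟩ := hfb z h u _ hRh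
  have hℰ : ℰ z (i q) = is (C ((z : ℂ) • k) + D' q) := by
    refine transfer_apply_of_eq (norm_le_of_colligation hM) z.norm_lt_one (x := k) ?_ ?_
    · simpa using h3
    · simp
  refine (D.redheffer_apply_of_feedback i is ℰ z.norm_lt_one (x := j.adjoint h) (e := i q) ?_).symm
  rw [hℰ, h1, D.U_toLp_add, LinearIsometryEquiv.symm_apply_apply, h2]

theorem norm_y_le (hP : D.y.adjoint ∘L D.y ≤ D.P) (x : 𝒳) : ‖D.y x‖ ≤ ‖D.sqrtP₀ x‖ := by
  have h1 := (ContinuousLinearMap.le_def _ _).mp hP |>.re_inner_nonneg_left x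
  rw [sub_apply, inner_sub_left, map_sub, ← D.sqrtP_comp] at h1
  simp only [ContinuousLinearMap.comp_apply] at h1
  rw [inner_sqrtP, ContinuousLinearMap.adjoint_inner_left, inner_self_eq_norm_sq,
    inner_self_eq_norm_sq] at h1
  refine le_of_sq_le_sq ?_ (norm_nonneg _)
  change _ ≤ ‖D.sqrtP x‖ ^ 2
  linarith

theorem exists_sqrtP_eq (hP : D.y.adjoint ∘L D.y ≤ D.P) : ∃ v : D.X₀, D.sqrtP v = D.y.adjoint 1 := by
  let ℓ : D.X₀ →L[ℂ] ℂ := D.y.toLinearMap.extendOfNorm D.sqrtP₀.toLinearMap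
  have hℓ : ∀ x, ℓ (D.sqrtP₀ x) = D.y x := fun x =>
    LinearMap.extendOfNorm_eq D.denseRange_sqrtP₀ ⟨1, fun x => by rw [one_mul]; exact D.norm_y_le hP x⟩ x
  refine ⟨(InnerProductSpace.toDual ℂ D.X₀).symm ℓ, ext_inner_right ℂ fun x => ?_⟩
  rw [inner_sqrtP, ContinuousLinearMap.adjoint_inner_left]
  have := InnerProductSpace.toDual_symm_apply (𝕜 := ℂ) (x := D.sqrtP₀ x) (y := ℓ)
  rw [hℓ] at this
  refine Eq.trans this ?_
  simp

theorem norm_le_one_of_sqrtP_eq (hP : D.y.adjoint ∘L D.y ≤ D.P) {v : D.X₀}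
    (hv : D.sqrtP v = D.y.adjoint 1) : ‖v‖ ≤ 1 := by
  have h : ∀ w, ‖⟪v, w⟫_ℂ‖ ≤ ‖w‖ := fun w => by
    refine D.denseRange_sqrtP₀.induction_on (p := fun w => ‖⟪v, w⟫_ℂ‖ ≤ ‖w‖) w
      (isClosed_le (by fun_prop) (by fun_prop)) fun x => ?_
    rw [← ContinuousLinearMap.adjoint_inner_left, adjoint_sqrtP₀, hv,
      ContinuousLinearMap.adjoint_inner_left]
    simpa using D.norm_y_le hP x
  have h1 := h v
  rw [inner_self_eq_norm_sq_to_K, norm_pow, RCLike.norm_ofReal, abs_norm] at h1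
  by_contra! h2
  nlinarith

end AdmissibleData

end DBR

end

theorem theorem4p10
    {𝒳 𝒰 𝒴 Δ' Δs' : Type*}
    [NormedAddCommGroup 𝒳] [InnerProductSpace ℂ 𝒳] [CompleteSpace 𝒳]
    [NormedAddCommGroup 𝒰] [InnerProductSpace ℂ 𝒰] [CompleteSpace 𝒰]
    [NormedAddCommGroup 𝒴] [InnerProductSpace ℂ 𝒴] [CompleteSpace 𝒴]
    [NormedAddCommGroup Δ'] [InnerProductSpace ℂ Δ'] [CompleteSpace Δ']
    [NormedAddCommGroup Δs'] [InnerProductSpace ℂ Δs'] [CompleteSpace Δs']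
    (D : DBR.AdmissibleData 𝒳 𝒰 𝒴) (i : D.Δ ≃ₗᵢ[ℂ] Δ') (is : D.Δs ≃ₗᵢ[ℂ] Δs')
    (hP : D.y.adjoint ∘L D.y ≤ D.P) :
    (∃! v : D.X₀, D.sqrtP v = D.y.adjoint 1) ∧
    (∃ ℰ : DBR.SchurFunction Δ' Δs', D.IsRedhefferParameter i is ℰ) ∧
    ∀ (ytil : D.X₀) (ℰ : DBR.SchurFunction Δ' Δs'),
      D.sqrtP ytil = D.y.adjoint 1 → D.IsRedhefferParameter i is ℰ →
      ‖ytil‖ ≤ 1 ∧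
      (∀ f : 𝔻 → 𝒴, (∃ F : DBR.H D.S, ⇑F = f ∧ D.IsSolution F) ↔
        ∃ h : DBR.H ℰ, ‖h‖ ≤ √(1 - ‖ytil‖ ^ 2) ∧
          ∀ z : 𝔻, f z = D.Γ i is ℰ z ytil + D.G i is ℰ z (h z)) ∧
      ∃ (fmin : DBR.H D.S) (MG : DBR.H ℰ →L[ℂ] DBR.H D.S),
        (∀ z : 𝔻, fmin z = D.Γ i is ℰ z ytil) ∧
        (∀ (h : DBR.H ℰ) (z : 𝔻), MG h z = D.G i is ℰ z (h z)) ∧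
        (∀ (h : DBR.H ℰ) (f : DBR.H D.S),
          (∀ z : 𝔻, f z = D.Γ i is ℰ z ytil + D.G i is ℰ z (h z)) →
          ‖f‖ ^ 2 = ‖fmin‖ ^ 2 + ‖MG h‖ ^ 2 ∧
          ‖f‖ ^ 2 = ‖ytil‖ ^ 2 + ‖MG.kerᗮ.starProjection h‖ ^ 2) ∧
        D.IsSolution fmin ∧
        ∀ f : DBR.H D.S, D.IsSolution f → f ≠ fmin → ‖fmin‖ < ‖f‖ := by
  refine ⟨?_, D.exists_redhefferParameter i is, fun ytil ℰ hy hℰ => ?_⟩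
  · obtain ⟨v, hv⟩ := D.exists_sqrtP_eq hP
    exact ⟨v, hv, fun w hw => D.sqrtP_injOn (hw.trans hv.symm)⟩
  have hy1 := D.norm_le_one_of_sqrtP_eq hP hy
  obtain ⟨M, N, hM, hN, hMF, hMM, hMN⟩ := D.exists_complementary i is ℰ hℰ
  have hFS : ∀ f, D.FS.adjoint f = D.sqrtP (M.adjoint f) := fun f => by
    have : D.FS = M ∘L D.sqrtP₀ := ContinuousLinearMap.ext fun x => (hMF x).symm
    rw [this, ContinuousLinearMap.adjoint_comp, ContinuousLinearMap.comp_apply, D.adjoint_sqrtP₀]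
  have hsol : ∀ f, D.FS.adjoint f = D.y.adjoint 1 ↔ M.adjoint f = ytil := fun f => by
    rw [hFS, ← hy]
    exact ⟨fun h => D.sqrtP_injOn h, fun h => by rw [h]⟩
  have hdec : ∀ k, M.adjoint (M ytil + N k) = ytil := fun k => by
    rw [map_add, hMM, DBR.adjoint_apply_eq_zero_of_complementary hMM hMN, add_zero]
  have hnorm := DBR.norm_add_sq_of_complementary hMM hMN ytil
  have hproj := DBR.norm_apply_of_complementary hMM hMN
  have hmin : ‖M ytil‖ ^ 2 = ‖ytil‖ ^ 2 := by simpa using hnorm 0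
  have heq : ∀ (f : 𝔻 → 𝒴) (F : DBR.H D.S) (k : DBR.H ℰ), ⇑F = f →
      ((∀ z : 𝔻, f z = D.Γ i is ℰ z ytil + D.G i is ℰ z (k z)) ↔ F = M ytil + N k) := by
    rintro _ F k rfl
    simp only [← hM, ← hN]
    refine ⟨fun h => RKHS.ext fun z => ?_, fun h z => ?_⟩
    · rw [h, RKHS.coe_add, Pi.add_apply]
    · rw [h, RKHS.coe_add, Pi.add_apply]
  refine ⟨hy1, fun f => ⟨?_, ?_⟩, M ytil, N, hM ytil, hN, fun h f hf => ?_, ?_, fun f hf hne => ?_⟩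
  · rintro ⟨F, hF, hF1, hF2⟩
    have h1 : F = M ytil + N (N.adjoint F) := by
      rw [← (hsol F).mp hF1, hMN]
    refine ⟨N.kerᗮ.starProjection (N.adjoint F), ?_, (heq f F _ hF).mpr ?_⟩
    · have h2 := hnorm (N.adjoint F)
      rw [← h1] at h2
      rw [← hproj]
      refine Real.le_sqrt_of_sq_le ?_
      nlinarith [norm_nonneg F]
    · rw [DBR.starProjection_ker_orthogonal_of_complementary hMM hMN,
        DBR.apply_adjoint_apply_of_complementary hMM hMN, ← h1]
  · rintro ⟨h, hh, hf⟩
    refine ⟨M ytil + N h, ?_, (hsol _).mpr (hdec h), ?_⟩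
    · ext z
      rw [hf, RKHS.coe_add, Pi.add_apply, hM, hN]
    · have h1 := hnorm h
      have h2 : ‖N h‖ ≤ ‖h‖ := by
        rw [hproj]; exact Submodule.norm_starProjection_apply_le _ _
      have h3 : ‖h‖ ^ 2 ≤ 1 - ‖ytil‖ ^ 2 := by
        rw [← Real.sq_sqrt (show (0 : ℝ) ≤ 1 - ‖ytil‖ ^ 2 by nlinarith [norm_nonneg ytil])]
        gcongr
      refine le_of_sq_le_sq ?_ zero_le_one
      nlinarith [norm_nonneg (N h)]
  · have h1 := (heq f f h rfl).mp hf
    rw [h1, hmin, ← hproj, hnorm]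
    exact ⟨rfl, rfl⟩
  · refine ⟨(hsol _).mpr (hMM ytil), ?_⟩
    rw [sq_eq_sq₀ (norm_nonneg _) (norm_nonneg _)] at hmin
    rwa [hmin]
  · have h1 : f = M ytil + N (N.adjoint f) := by
      rw [← (hsol f).mp hf.1, hMN]
    have h2 := hnorm (N.adjoint f)
    rw [← h1, ← hmin] at h2
    have h3 : 0 < ‖N (N.adjoint f)‖ := by
      rw [norm_pos_iff]
      intro h0
      rw [h0, add_zero] at h1
      exact hne h1
    refine lt_of_pow_lt_pow_left₀ 2 (norm_nonneg _) ?_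
    rw [h2]
    linarith [pow_pos h3 2]
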